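/- All algebras are associative complex algebras, not necessarily unital; ideals are two-sided linear subspaces. An ideal map on Banach algebras assigns to each Banach algebra $A$ an ideal $P(A)$; write $P\le Q$ if $P(A)\subset Q(A)$ for every Banach algebra $A$. A topological radical is an ideal map $P$ with every $P(A)$ closed such that, for all Banach algebras $A,B$: (1) $f(P(A))\subset P(B)$ for every open continuous surjective homomorphism $f:A\to B$; (2) $P(A/P(A))=0$; (3) $P(P(A))=P(A)$; (4) for each closed ideal $I$ of $A$, $P(I)$ is an ideal of $A$ contained in $P(A)$. For an algebra $A$ let $\operatorname{rad}(A)$ be its Jacobson radical, $\operatorname{soc}(A)$ the sum of its minimal left ideals, and $\operatorname{psoc}(A)$ the preimage in $A$ of $\operatorname{soc}(A/\operatorname{rad}(A))$. Let $\operatorname{Rad}$ be the restriction of $\operatorname{rad}$ to Banach algebras. The scattered radical $\mathcal R_s(A)=\operatorname{psoc}^*(A)$ of a Banach algebra $A$ is the ideal at which the increasing transfinite chain $I_0=0$, $I_{\alpha+1}=$ the preimage in $A$ of $\operatorname{psoc}(A/I_\alpha)$, $I_\alpha=\bigcup_{\beta<\alpha}I_\beta$ for limit $\alpha$, stabilizes.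 An element $a$ of a normed algebra $A$ is compact if $x\mapsto axa$ is a compact operator on $A$, and of finite rank if $\dim aAa<\infty$. A normed algebra is hypocompact (respectively, hypofinite) if each of its non-zero quotients by a closed ideal has a non-zero compact (respectively, finite rank) element. For a Banach algebra $A$, $\mathcal R_{hc}(A)$ and $\mathcal R_{hf}(A)$ denote the largest hypocompact and the largest hypofinite closed ideal of $A$. For ideal maps $P,Q$ on Banach algebras put $H(A)=\overline{P(A)+Q(A)}$ and let $(P\vee Q)(A)$ be the ideal at which the increasing transfinite chain of closed ideals $I_0=0$, $I_{\alpha+1}=$ the preimage in $A$ of $H(A/I_\alpha)$, $I_\alpha=\overline{\bigcup_{\beta<\alpha}I_\beta}$ for limit $\alpha$, stabilizes. **Theorem.** On Banach algebras, $$\mathcal R_{hc}\le\mathcal R_s=\mathcal R_{hf}\vee\operatorname{Rad}=\mathcal R_{hc}\vee\operatorname{Rad}.$$ Moreover $\mathcal R_s$ is a topological radical on Banach algebras, and it is the supremum in the class of topological radicals both of $\mathcal R_{hf}$ and $\operatorname{Rad}$ and of $\mathcal R_{hc}$ and $\operatorname{Rad}$: it is larger than or equal to each of them, and $\mathcal R_s\le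 T$ for every topological radical $T$ with $\mathcal R_{hf},\operatorname{Rad}\le T$, and for every topological radical $T$ with $\mathcal R_{hc},\operatorname{Rad}\le T$. -/

import Mathlib

universe u

noncomputable section

/-! ## Ideals of (possibly non-unital) complex algebras and their quotients -/

section Algebraic

set_option linter.unusedSectionVars false

variable (A : Type u) [NonUnitalRing A] [Module ℂ A] [IsScalarTower ℂ A A] [SMulCommClass ℂ A A]

/-- A two-sided ideal of a complex algebra: a linear subspace which absorbs multiplication
on both sides. -/
@[ext]
structure AlgIdeal extends Submodule ℂ A where
  mul_left_mem : ∀ (a : A) {x : A}, x ∈ toSubmodule → a * x ∈ toSubmodule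
  mul_right_mem : ∀ {x : A} (a : A), x ∈ toSubmodule → x * a ∈ toSubmodule

variable {A}

namespace AlgIdeal

instance : SetLike (AlgIdeal A) A where
  coe I := I.toSubmodule
  coe_injective := by
    intro I J h
    ext x
    exact Set.ext_iff.mp h x

/-- Ideals are ordered by inclusion. -/
instance : PartialOrder (AlgIdeal A) := PartialOrder.ofSetLike (AlgIdeal A) A

/-- The zero ideal. -/
instance : Bot (AlgIdeal A) where
  bot :=
    { (⊥ : Submodule ℂ A) with
      mul_left_mem := by intro a x hx; change a * x = 0; rw [show x = 0 from hx, mul_zero]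
      mul_right_mem := by intro x a hx; change x * a = 0; rw [show x = 0 from hx, zero_mul] }

/-- The whole algebra. -/
instance : Top (AlgIdeal A) where
  top :=
    { (⊤ : Submodule ℂ A) with
      mul_left_mem := fun _ _ _ => trivial
      mul_right_mem := fun _ _ => trivial }

/-- The sum of a family of ideals. -/
protected def iSup {ι : Sort*} (I : ι → AlgIdeal A) : AlgIdeal A where
  toSubmodule := ⨆ i, (I i).toSubmodule
  mul_left_mem := by
    intro a x hx
    have h : (⨆ i, (I i).toSubmodule) ≤
        (⨆ i, (I i).toSubmodule).comap (LinearMap.mulLeft ℂ a) :=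
      iSup_le fun i y hy => Submodule.mem_iSup_of_mem i ((I i).mul_left_mem a hy)
    exact h hx
  mul_right_mem := by
    intro x a hx
    have h : (⨆ i, (I i).toSubmodule) ≤
        (⨆ i, (I i).toSubmodule).comap (LinearMap.mulRight ℂ a) :=
      iSup_le fun i y hy => Submodule.mem_iSup_of_mem i ((I i).mul_right_mem a hy)
    exact h hx

/-- An ideal, viewed as a (non-unital) subalgebra. All structure on the algebra `↥I.toSubalg`,
in particular the norm when `A` is normed, is inherited from `A`. -/
def toSubalg (I : AlgIdeal A) : NonUnitalSubalgebra ℂ A where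
  carrier := I
  add_mem' := I.add_mem
  zero_mem' := I.zero_mem
  smul_mem' := fun c _ hx => I.toSubmodule.smul_mem c hx
  mul_mem' := fun {a} _ _ hb => I.mul_left_mem a hb

/-- The quotient `A / I`. -/
def Quot (I : AlgIdeal A) : Type u := A ⧸ I.toSubmodule

variable (I : AlgIdeal A)

instance : AddCommGroup I.Quot := inferInstanceAs (AddCommGroup (A ⧸ I.toSubmodule))
instance : Module ℂ I.Quot := inferInstanceAs (Module ℂ (A ⧸ I.toSubmodule))

/-- The quotient map, as a linear map. -/
def mkL : A →ₗ[ℂ] I.Quot := I.toSubmodule.mkQ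

theorem mkL_surjective : Function.Surjective I.mkL := I.toSubmodule.mkQ_surjective

instance : Mul I.Quot where
  mul := Quotient.map₂ (· * ·) (by
    intro a a' h b b' h'
    have h1 : a - a' ∈ I := (Submodule.quotientRel_def _).mp h
    have h2 : b - b' ∈ I := (Submodule.quotientRel_def _).mp h'
    refine (Submodule.quotientRel_def _).mpr ?_
    have : a * b - a' * b' = (a - a') * b + a' * (b - b') := by noncomm_ring
    rw [this]
    exact I.add_mem (I.mul_right_mem b h1) (I.mul_left_mem a' h2))

theorem mkL_mul (x y : A) : I.mkL (x * y) = I.mkL x * I.mkL y := rfl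

instance : NonUnitalRing I.Quot where
  left_distrib a b c := by
    obtain ⟨a, rfl⟩ := I.mkL_surjective a
    obtain ⟨b, rfl⟩ := I.mkL_surjective b
    obtain ⟨c, rfl⟩ := I.mkL_surjective c
    rw [← map_add, ← mkL_mul, ← mkL_mul, ← mkL_mul, ← map_add, mul_add]
  right_distrib a b c := by
    obtain ⟨a, rfl⟩ := I.mkL_surjective a
    obtain ⟨b, rfl⟩ := I.mkL_surjective b
    obtain ⟨c, rfl⟩ := I.mkL_surjective c
    rw [← map_add, ← mkL_mul, ← mkL_mul, ← mkL_mul, ← map_add, add_mul]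
  zero_mul a := by
    obtain ⟨a, rfl⟩ := I.mkL_surjective a
    rw [← map_zero I.mkL, ← mkL_mul, zero_mul]
  mul_zero a := by
    obtain ⟨a, rfl⟩ := I.mkL_surjective a
    rw [← map_zero I.mkL, ← mkL_mul, mul_zero]
  mul_assoc a b c := by
    obtain ⟨a, rfl⟩ := I.mkL_surjective a
    obtain ⟨b, rfl⟩ := I.mkL_surjective b
    obtain ⟨c, rfl⟩ := I.mkL_surjective c
    rw [← mkL_mul, ← mkL_mul, ← mkL_mul, ← mkL_mul, mul_assoc]

instance : IsScalarTower ℂ I.Quot I.Quot where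
  smul_assoc r a b := by
    obtain ⟨a, rfl⟩ := I.mkL_surjective a
    obtain ⟨b, rfl⟩ := I.mkL_surjective b
    rw [smul_eq_mul, smul_eq_mul, ← map_smul, ← mkL_mul, ← mkL_mul, ← map_smul, smul_mul_assoc]

instance : SMulCommClass ℂ I.Quot I.Quot where
  smul_comm r a b := by
    obtain ⟨a, rfl⟩ := I.mkL_surjective a
    obtain ⟨b, rfl⟩ := I.mkL_surjective b
    rw [smul_eq_mul, smul_eq_mul, ← map_smul, ← mkL_mul, ← mkL_mul, ← map_smul, mul_smul_comm]

/-- The quotient map `q_I : A → A / I`, as a homomorphism of algebras. -/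
def quotMap : A →ₙₐ[ℂ] I.Quot where
  toFun := I.mkL
  map_smul' := map_smul I.mkL
  map_zero' := map_zero I.mkL
  map_add' := map_add I.mkL
  map_mul' := I.mkL_mul

/-- The preimage in `A` of an ideal of `A / I`. -/
def preimage (J : AlgIdeal I.Quot) : AlgIdeal A where
  toSubmodule := J.toSubmodule.comap I.mkL
  mul_left_mem := by
    intro a x hx
    change I.mkL (a * x) ∈ J
    rw [mkL_mul]
    exact J.mul_left_mem _ hx
  mul_right_mem := by
    intro x a hx
    change I.mkL (x * a) ∈ J
    rw [mkL_mul]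
    exact J.mul_right_mem _ hx

end AlgIdeal

/-! ## The Jacobson radical, the socle and the presocle of an algebra -/

variable (A)

/-- The Jacobson radical `rad A` of a possibly non-unital algebra: the part lying in `A` of the
Jacobson radical of the algebra obtained from `A` by adjoining an identity. -/
def jacobsonIdeal : AlgIdeal A where
  toSubmodule :=
    { carrier := {x | (x : Unitization ℂ A) ∈ Ring.jacobson (Unitization ℂ A)}
      add_mem' := by
        intro x y hx hy
        simp only [Set.mem_ofPred_eq, Unitization.inr_add] at *
        exact Submodule.add_mem _ hx hy
      zero_mem' := by simp
      smul_mem' := by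
        intro c x hx
        have h := (Ring.jacobson (Unitization ℂ A)).smul_mem
          (algebraMap ℂ (Unitization ℂ A) c) hx
        rw [smul_eq_mul, ← Algebra.smul_def, ← Unitization.inr_smul] at h
        exact h }
  mul_left_mem := by
    intro a x hx
    change ((a * x : A) : Unitization ℂ A) ∈ Ring.jacobson (Unitization ℂ A)
    rw [Unitization.inr_mul]
    exact Ideal.mul_mem_left _ _ hx
  mul_right_mem := by
    intro x a hx
    change ((x * a : A) : Unitization ℂ A) ∈ Ring.jacobson (Unitization ℂ A)
    rw [Unitization.inr_mul]
    exact Ideal.mul_mem_right _ _ hx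

variable {A}

/-- A linear subspace `L` is a left ideal. -/
def IsLeftIdeal (L : Submodule ℂ A) : Prop := ∀ (a : A), ∀ x ∈ L, a * x ∈ L

/-- `L` is a minimal left ideal: it is minimal among the non-zero left ideals. -/
def IsMinimalLeftIdeal (L : Submodule ℂ A) : Prop :=
  Minimal (fun M : Submodule ℂ A => IsLeftIdeal M ∧ M ≠ ⊥) L

theorem IsMinimalLeftIdeal.map_mulRight {L : Submodule ℂ A} (hL : IsMinimalLeftIdeal L) (a : A)
    (h : L.map (LinearMap.mulRight ℂ a) ≠ ⊥) :
    IsMinimalLeftIdeal (L.map (LinearMap.mulRight ℂ a)) := by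
  refine ⟨⟨?_, h⟩, ?_⟩
  · rintro b _ ⟨x, hx, rfl⟩
    exact ⟨b * x, hL.prop.1 b x hx, by simp [mul_assoc]⟩
  · rintro M ⟨hM, hM0⟩ hML
    have hN : L ≤ L ⊓ M.comap (LinearMap.mulRight ℂ a) := by
      refine hL.le_of_le ⟨?_, ?_⟩ inf_le_left
      · rintro b x ⟨hx, hx'⟩
        refine ⟨hL.prop.1 b x hx, ?_⟩
        have := hM b _ hx'
        simpa [mul_assoc] using this
      · intro h0
        apply hM0
        rw [eq_bot_iff]
        intro y hy
        obtain ⟨x, hx, rfl⟩ := hML hy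
        have hx0 : x ∈ L ⊓ M.comap (LinearMap.mulRight ℂ a) := ⟨hx, hy⟩
        rw [h0, Submodule.mem_bot] at hx0
        simp [hx0]
    rintro _ ⟨x, hx, rfl⟩
    exact (hN hx).2

variable (A)

/-- The socle `soc A`: the sum of all minimal left ideals of `A`. -/
def socle : AlgIdeal A where
  toSubmodule := sSup {L | IsMinimalLeftIdeal L}
  mul_left_mem := by
    intro a x hx
    have h : sSup {L : Submodule ℂ A | IsMinimalLeftIdeal L} ≤
        (sSup {L | IsMinimalLeftIdeal L}).comap (LinearMap.mulLeft ℂ a) :=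
      sSup_le fun L (hL : IsMinimalLeftIdeal L) y hy =>
        (le_sSup hL : L ≤ sSup {L | IsMinimalLeftIdeal L}) (hL.prop.1 a y hy)
    exact h hx
  mul_right_mem := by
    intro x a hx
    have h : sSup {L : Submodule ℂ A | IsMinimalLeftIdeal L} ≤
        (sSup {L | IsMinimalLeftIdeal L}).comap (LinearMap.mulRight ℂ a) := by
      refine sSup_le fun L (hL : IsMinimalLeftIdeal L) => ?_
      rw [← Submodule.map_le_iff_le_comap]
      by_cases h0 : L.map (LinearMap.mulRight ℂ a) = ⊥
      · rw [h0]; exact bot_le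
      · exact le_sSup (hL.map_mulRight a h0)
    exact h hx

/-- The presocle `psoc A`: the preimage in `A` of the socle of `A / rad A`. -/
def presocle : AlgIdeal A :=
  (jacobsonIdeal A).preimage (socle (jacobsonIdeal A).Quot)

/-- The transfinite algebraic convolution chain generated by the presocle:
`I₀ = 0`, `I_{α+1}` is the preimage of `psoc (A / I_α)`, and `I_α` is the sum (that is, the union)
of the preceding ideals for a limit ordinal `α`. -/
def presocleChain (α : Ordinal.{u}) : AlgIdeal A :=
  Ordinal.limitRecOn α ⊥ (fun _ I => I.preimage (presocle I.Quot))
    (fun β _ I => AlgIdeal.iSup fun γ : Set.Iio β => I γ.1 γ.2)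

/-- The ideal `psoc* A` at which the (increasing) chain generated by the presocle stabilizes. -/
def presocleStar : AlgIdeal A := AlgIdeal.iSup (presocleChain A)

/-- `a` is a finite rank element of `A`: the space `a A a` is finite-dimensional. -/
def IsFiniteRankElement (a : A) : Prop :=
  FiniteDimensional ℂ (LinearMap.range (LinearMap.mulLeft ℂ a ∘ₗ LinearMap.mulRight ℂ a))

end Algebraic

/-! ## Closed ideals of normed algebras -/

section Normed

variable (A : Type u) [NonUnitalNormedRing A] [NormedSpace ℂ A] [IsScalarTower ℂ A A]
  [SMulCommClass ℂ A A]

/-- A closed two-sided ideal of a normed algebra. -/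
@[ext]
structure ClosedIdeal extends AlgIdeal A where
  isClosed : IsClosed (toAlgIdeal : Set A)

variable {A}

/-- The closure of an ideal. -/
def AlgIdeal.closure (I : AlgIdeal A) : ClosedIdeal A where
  toSubmodule := I.toSubmodule.topologicalClosure
  mul_left_mem := fun a _ hx =>
    map_mem_closure (f := fun y => a * y) (by fun_prop) hx fun _ hy => I.mul_left_mem a hy
  mul_right_mem := fun a hx =>
    map_mem_closure (f := fun y => y * a) (by fun_prop) hx fun _ hy => I.mul_right_mem a hy
  isClosed := I.toSubmodule.isClosed_topologicalClosure

namespace ClosedIdeal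

variable (I : ClosedIdeal A)

/-- The zero ideal. -/
instance : Bot (ClosedIdeal A) where
  bot := { (⊥ : AlgIdeal A) with isClosed := isClosed_singleton }

/-- The quotient `A / I` by a closed ideal. -/
abbrev Quot : Type u := I.toAlgIdeal.Quot

/-- A closed ideal, as an algebra with the norm of `A`. -/
abbrev Carrier : Type u := I.toAlgIdeal.toSubalg

instance : IsClosed (I.toSubmodule : Set A) := I.isClosed

instance : NormedAddCommGroup I.Quot :=
  inferInstanceAs (NormedAddCommGroup (A ⧸ I.toSubmodule))

/-- `A / I` with its quotient norm is a normed algebra. -/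
instance : NonUnitalNormedRing I.Quot where
  __ := (inferInstance : NormedAddCommGroup I.Quot)
  __ := (inferInstance : NonUnitalRing I.Quot)
  norm_mul_le x y := le_of_forall_pos_le_add fun ε hε => by
    have key : Filter.Tendsto (fun δ : ℝ => (‖x‖ + δ) * (‖y‖ + δ)) (nhdsWithin 0 (Set.Ioi 0))
        (nhds (‖x‖ * ‖y‖)) := by
      have : ContinuousAt (fun δ : ℝ => (‖x‖ + δ) * (‖y‖ + δ)) 0 := by fun_prop
      simpa using this.tendsto.mono_left nhdsWithin_le_nhds
    obtain ⟨δ, hδ, hδ0⟩ := ((key.eventually_lt_const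
      (lt_add_of_pos_right (‖x‖ * ‖y‖) hε)).and self_mem_nhdsWithin).exists
    obtain ⟨a, rfl, ha⟩ := Submodule.Quotient.norm_mk_lt (S := I.toSubmodule) x hδ0
    obtain ⟨b, rfl, hb⟩ := Submodule.Quotient.norm_mk_lt (S := I.toSubmodule) y hδ0
    refine le_trans ?_ hδ.le
    calc _ ≤ ‖a * b‖ := Submodule.Quotient.norm_mk_le I.toSubmodule (a * b)
      _ ≤ ‖a‖ * ‖b‖ := norm_mul_le a b
      _ ≤ _ := mul_le_mul ha.le hb.le (norm_nonneg _) ((norm_nonneg _).trans ha.le)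

instance : NormedSpace ℂ I.Quot where
  __ := (inferInstance : Module ℂ I.Quot)
  norm_smul_le := (inferInstance : NormedSpace ℂ (A ⧸ I.toSubmodule)).norm_smul_le

instance : NormedSpace ℂ I.Carrier where
  __ := (inferInstance : Module ℂ I.Carrier)
  norm_smul_le c x := norm_smul_le c (x : A)

instance [CompleteSpace A] : CompleteSpace I.Quot :=
  inferInstanceAs (CompleteSpace (A ⧸ I.toSubmodule))

instance [CompleteSpace A] : CompleteSpace I.Carrier :=
  I.isClosed.completeSpace_coe

/-- The preimage in `A` of a closed ideal of `A / I`. -/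
def preimage (J : ClosedIdeal I.Quot) : ClosedIdeal A where
  toAlgIdeal := I.toAlgIdeal.preimage J.toAlgIdeal
  isClosed := J.isClosed.preimage (f := I.toAlgIdeal.mkL)
    (AddMonoidHomClass.continuous_of_bound I.toAlgIdeal.mkL 1 fun x => by
      rw [one_mul]; exact Submodule.Quotient.norm_mk_le I.toSubmodule x)

end ClosedIdeal

/-! ## Hypofinite and hypocompact algebras -/

/-- `a` is a compact element of `A`: the map `x ↦ a x a` is a compact operator on `A`. -/
def IsCompactMulElement (a : A) : Prop := IsCompactOperator fun x : A => a * x * a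

variable (A)

/-- `A` is hypocompact: every non-zero quotient of `A` by a closed ideal has a non-zero compact
element. -/
def IsHypocompact : Prop :=
  ∀ L : ClosedIdeal A, L.toAlgIdeal ≠ ⊤ → ∃ a : L.Quot, a ≠ 0 ∧ IsCompactMulElement a

/-- `A` is (closed-)hypofinite: every non-zero quotient of `A` by a closed ideal has a non-zero
finite rank element. -/
def IsHypofinite : Prop :=
  ∀ L : ClosedIdeal A, L.toAlgIdeal ≠ ⊤ → ∃ a : L.Quot, a ≠ 0 ∧ IsFiniteRankElement L.Quot a

end Normed

/-! ## Ideal maps and radicals on Banach algebras -/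

/-- An ideal map on the class of complex Banach algebras: it assigns an ideal to each of them. -/
@[ext]
structure IdealMap where
  toFun : ∀ (A : Type u) [NonUnitalNormedRing A] [NormedSpace ℂ A] [IsScalarTower ℂ A A]
    [SMulCommClass ℂ A A] [CompleteSpace A], AlgIdeal A

instance : CoeFun IdealMap.{u} (fun _ => ∀ (A : Type u) [NonUnitalNormedRing A] [NormedSpace ℂ A]
    [IsScalarTower ℂ A A] [SMulCommClass ℂ A A] [CompleteSpace A], AlgIdeal A) := ⟨IdealMap.toFun⟩

/-- `P ≤ Q` if `P A ⊆ Q A` for each Banach algebra `A`. -/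
instance : LE IdealMap.{u} where
  le P Q := ∀ (A : Type u) [NonUnitalNormedRing A] [NormedSpace ℂ A] [IsScalarTower ℂ A A]
    [SMulCommClass ℂ A A] [CompleteSpace A], P A ≤ Q A

section Radicals

/-- The radical `Rad`: the restriction of the Jacobson radical to Banach algebras. -/
def jacobsonRadical : IdealMap.{u} where
  toFun A := jacobsonIdeal A

/-- The scattered radical `psoc*` on Banach algebras. -/
def scatteredRadical : IdealMap.{u} where
  toFun A := presocleStar A

/-- The hypocompact radical: the supremum (in the lattice of closed ideals) of the closed
hypocompact ideals, i.e. the largest hypocompact ideal. -/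
def hypocompactRadical : IdealMap.{u} where
  toFun A := (AlgIdeal.closure (AlgIdeal.iSup
    fun I : {I : ClosedIdeal A // IsHypocompact I.Carrier} => I.1.toAlgIdeal)).toAlgIdeal

/-- The (closed-)hypofinite radical: the supremum (in the lattice of closed ideals) of the closed
hypofinite ideals, i.e. the largest closed-hypofinite ideal. -/
def hypofiniteRadical : IdealMap.{u} where
  toFun A := (AlgIdeal.closure (AlgIdeal.iSup
    fun I : {I : ClosedIdeal A // IsHypofinite I.Carrier} => I.1.toAlgIdeal)).toAlgIdeal

namespace IdealMap

variable (P Q : IdealMap.{u})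

section

variable (A : Type u) [NonUnitalNormedRing A] [NormedSpace ℂ A] [IsScalarTower ℂ A A]
  [SMulCommClass ℂ A A] [CompleteSpace A]

/-- The closed ideal map `H`, `H A = closure (P A + Q A)`. -/
def closedSum : ClosedIdeal A :=
  AlgIdeal.closure (AlgIdeal.iSup fun b : Bool => if b then P A else Q A)

/-- The topological convolution chain generated by `H = closedSum P Q`: `I₀ = 0`, `I_{α+1}` is the
preimage of `H (A / I_α)`, and `I_α` is the closure of the sum (that is, of the union) of the
preceding ideals for a limit ordinal `α`. -/
def convChain (α : Ordinal.{u}) : ClosedIdeal A :=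
  Ordinal.limitRecOn α ⊥ (fun _ I => I.preimage (closedSum P Q I.Quot))
    (fun β _ I => AlgIdeal.closure (AlgIdeal.iSup fun γ : Set.Iio β => (I γ.1 γ.2).toAlgIdeal))

end

/-- The operation `P ∨ Q`, namely `H*` for `H A = closure (P A + Q A)`; the value at `A` is the
ideal at which the (increasing) convolution chain of `H` stabilizes. -/
def join : IdealMap.{u} where
  toFun A := AlgIdeal.iSup fun α : Ordinal.{u} => (convChain P Q A α).toAlgIdeal

/-- `P` is a topological radical on the class of Banach algebras. -/
structure IsTopologicalRadical : Prop where
  /-- `P` is a closed ideal map. -/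
  isClosed : ∀ (A : Type u) [NonUnitalNormedRing A] [NormedSpace ℂ A] [IsScalarTower ℂ A A]
    [SMulCommClass ℂ A A] [CompleteSpace A], IsClosed (P A : Set A)
  /-- `f (P A) ⊆ P B` for each open continuous surjective homomorphism `f : A → B`. -/
  map_mem : ∀ (A B : Type u) [NonUnitalNormedRing A] [NormedSpace ℂ A] [IsScalarTower ℂ A A]
    [SMulCommClass ℂ A A] [CompleteSpace A] [NonUnitalNormedRing B] [NormedSpace ℂ B]
    [IsScalarTower ℂ B B] [SMulCommClass ℂ B B] [CompleteSpace B] (f : A →ₙₐ[ℂ] B),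
    Continuous f → IsOpenMap f → Function.Surjective f → ∀ x ∈ P A, f x ∈ P B
  /-- `P (A / P A) = 0`. -/
  quotient_eq_bot : ∀ (A : Type u) [NonUnitalNormedRing A] [NormedSpace ℂ A] [IsScalarTower ℂ A A]
    [SMulCommClass ℂ A A] [CompleteSpace A] (I : ClosedIdeal A), I.toAlgIdeal = P A → P I.Quot = ⊥
  /-- `P (P A) = P A`. -/
  idem : ∀ (A : Type u) [NonUnitalNormedRing A] [NormedSpace ℂ A] [IsScalarTower ℂ A A]
    [SMulCommClass ℂ A A] [CompleteSpace A] (I : ClosedIdeal A), I.toAlgIdeal = P A →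
    P I.Carrier = ⊤
  /-- `P I` is an ideal of `A` contained in `P A`, for each closed ideal `I` of `A`. -/
  ideal : ∀ (A : Type u) [NonUnitalNormedRing A] [NormedSpace ℂ A] [IsScalarTower ℂ A A]
    [SMulCommClass ℂ A A] [CompleteSpace A] (I : ClosedIdeal A),
    ∃ K : AlgIdeal A, (K : Set A) = (fun x : I.Carrier => (x : A)) '' (P I.Carrier : Set I.Carrier)
      ∧ K ≤ P A

/-- `S` is the supremum of `P` and `Q` in the class of topological radicals on Banach algebras. -/
def IsRadicalSupremum (S P Q : IdealMap.{u}) : Prop :=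
  S.IsTopologicalRadical ∧ P ≤ S ∧ Q ≤ S ∧
    ∀ T : IdealMap.{u}, T.IsTopologicalRadical → P ≤ T → Q ≤ T → S ≤ T

end IdealMap

end Radicals

end

/-!
# The scattered radical as the join of the hypofinite and the Jacobson radicals

Call an algebra *of zero presocle* if it is semisimple and has no minimal left ideals
(`HasZeroPresocle`). The ideal `psoc* A` is the smallest ideal `K` of `A` such that `A / K` has
zero presocle (`hasZeroPresocle_quot_presocleStar`, `presocleStar_le_ker`), and the proof works with
this characterisation rather than with the transfinite chain.

*`psoc*` is a topological radical.* It is closed, since an ideal `J` of a Banach algebra with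
`rad (A / J) = 0` is closed: each element of its closure is quasi-regular modulo `J`, by a Neumann
series (`AlgIdeal.isClosed_of_jacobsonIdeal_quot_eq_bot`). It is hereditary,
`psoc* I = I ∩ psoc* A` for ideals `I` (`coe_mem_presocleStar`, `mem_presocleStar_of_coe_mem`),
because zero presocle passes from an algebra to its ideals and, in the other direction, from an
ideal with zero right annihilator to the whole algebra.

*Hypocompact algebras are scattered.* In a semisimple Banach algebra a non-zero compact element
gives a non-zero finite rank element, by the Fredholm alternative for `x ↦ c x c`
(`exists_isFiniteRankElement_of_isCompactMulElement`), and a non-zero finite rank element gives a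
minimal left ideal (`exists_isMinimalLeftIdeal_of_isFiniteRankElement`). So a hypocompact algebra
has no non-zero quotient by a closed ideal with zero presocle, and heredity gives the inclusion of
the hypocompact radical in the scattered one.

*Minimality.* In a semisimple Banach algebra each minimal left ideal contains an idempotent `e ≠ 0`
with `e A e ⊆ ℂ e`; this is Schur's lemma together with the non-emptiness of spectra
(`IsMinimalLeftIdeal.exists_mul_eq_smul`). The closed ideal generated by `e` is hypofinite
(`IsFiniteRankElement.isHypofinite_closure`). So if the hypofinite and the Jacobson radicals of
`A / K` vanish for a closed ideal `K`, then `A / K` has zero presocle, whence `psoc* A ⊆ K`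
(`presocleStar_le_of_quot`). This applies to the terms at which the convolution chains stabilize,
and to `K = T A` for a topological radical `T` above the two given ones.
-/

/-! ### Homomorphisms, kernels and quotients -/

section Hom

set_option linter.unusedSectionVars false

variable {A : Type*} [NonUnitalRing A] [Module ℂ A] [IsScalarTower ℂ A A] [SMulCommClass ℂ A A]
variable {B : Type*} [NonUnitalRing B] [Module ℂ B] [IsScalarTower ℂ B B] [SMulCommClass ℂ B B]

namespace AlgIdeal

theorem mem_bot {x : A} : x ∈ (⊥ : AlgIdeal A) ↔ x = 0 := Iff.rfl

theorem mem_top (x : A) : x ∈ (⊤ : AlgIdeal A) := trivial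

theorem bot_le (I : AlgIdeal A) : ⊥ ≤ I := by
  intro x hx
  rw [mem_bot.mp hx]
  exact I.zero_mem

theorem le_bot_iff {I : AlgIdeal A} : I ≤ ⊥ ↔ I = ⊥ :=
  ⟨fun h => le_antisymm h (bot_le I), fun h => h.le⟩

theorem le_iSup {ι : Sort*} (I : ι → AlgIdeal A) (i : ι) : I i ≤ AlgIdeal.iSup I :=
  fun _ hx => Submodule.mem_iSup_of_mem i hx

theorem iSup_le {ι : Sort*} {I : ι → AlgIdeal A} {J : AlgIdeal A} (h : ∀ i, I i ≤ J) :
    AlgIdeal.iSup I ≤ J := by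
  have : (⨆ i, (I i).toSubmodule) ≤ J.toSubmodule := _root_.iSup_le fun i _ hx => h i hx
  exact fun x hx => this hx

theorem quotMap_surjective (I : AlgIdeal A) : Function.Surjective I.quotMap := I.mkL_surjective

theorem quotMap_eq_zero {I : AlgIdeal A} {x : A} : I.quotMap x = 0 ↔ x ∈ I :=
  Submodule.Quotient.mk_eq_zero I.toSubmodule

theorem mem_preimage {I : AlgIdeal A} {J : AlgIdeal I.Quot} {x : A} :
    x ∈ I.preimage J ↔ I.quotMap x ∈ J := Iff.rfl

/-- The kernel of a homomorphism. -/
def ker (f : A →ₙₐ[ℂ] B) : AlgIdeal A where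
  toSubmodule := LinearMap.ker (f : A →ₗ[ℂ] B)
  mul_left_mem := by
    intro a x hx
    have hx : f x = 0 := hx
    change f (a * x) = 0
    rw [map_mul, hx, mul_zero]
  mul_right_mem := by
    intro x a hx
    have hx : f x = 0 := hx
    change f (x * a) = 0
    rw [map_mul, hx, zero_mul]

theorem mem_ker {f : A →ₙₐ[ℂ] B} {x : A} : x ∈ ker f ↔ f x = 0 := Iff.rfl

/-- The homomorphism `A / I → B` induced by a homomorphism `A → B` which vanishes on `I`. -/
def lift (I : AlgIdeal A) (f : A →ₙₐ[ℂ] B) (h : I ≤ ker f) : I.Quot →ₙₐ[ℂ] B where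
  toFun := I.toSubmodule.liftQ (f : A →ₗ[ℂ] B) (fun _ hx => h hx)
  map_smul' := map_smul _
  map_zero' := map_zero _
  map_add' := map_add _
  map_mul' x y := by
    obtain ⟨x, rfl⟩ := I.mkL_surjective x
    obtain ⟨y, rfl⟩ := I.mkL_surjective y
    exact map_mul f x y

theorem lift_surjective (I : AlgIdeal A) {f : A →ₙₐ[ℂ] B} (h : I ≤ ker f)
    (hf : Function.Surjective f) : Function.Surjective (I.lift f h) := fun b => by
  obtain ⟨a, rfl⟩ := hf b
  exact ⟨I.quotMap a, rfl⟩

/-- The inclusion of an ideal, viewed as an algebra. -/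
def incl (I : AlgIdeal A) : I.toSubalg →ₙₐ[ℂ] A := NonUnitalSubalgebraClass.subtype I.toSubalg

end AlgIdeal

/-- `ι : N → B` identifies the algebra `N` with a two-sided ideal of `B`. -/
structure IsIdealEmbedding (ι : A →ₙₐ[ℂ] B) : Prop where
  injective : Function.Injective ι
  mul_left : ∀ (b : B) (n : A), ∃ m, ι m = b * ι n
  mul_right : ∀ (n : A) (b : B), ∃ m, ι m = ι n * b

theorem IsIdealEmbedding.eq_zero {ι : A →ₙₐ[ℂ] B} (hι : IsIdealEmbedding ι) {x : A}
    (h : ι x = 0) : x = 0 := hι.injective (h.trans (map_zero ι).symm)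

/-! ### The Jacobson radical by quasi-regularity -/

/-- `u` is left quasi-regular: `1 + u` has a left inverse `1 + z` in the algebra with adjoined
identity. -/
def IsLeftQuasiRegular (u : A) : Prop := ∃ z : A, z + u + z * u = 0

theorem IsLeftQuasiRegular.map (f : A →ₙₐ[ℂ] B) {u : A} (h : IsLeftQuasiRegular u) :
    IsLeftQuasiRegular (f u) := by
  obtain ⟨z, hz⟩ := h
  exact ⟨f z, by rw [← map_mul, ← map_add, ← map_add, hz, map_zero]⟩

/-- If `(1 - u) (1 + u) = 1 - u * u` has a left inverse, then so has `1 + u`. -/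
theorem isLeftQuasiRegular_of_neg_mul_self {u : A} (h : IsLeftQuasiRegular (-(u * u))) :
    IsLeftQuasiRegular u := by
  obtain ⟨w, hw⟩ := h
  refine ⟨w - u - w * u, ?_⟩
  rw [← hw]
  noncomm_ring

theorem mem_jacobsonIdeal_iff {x : A} :
    x ∈ jacobsonIdeal A ↔ ∀ (c : ℂ) (a : A), IsLeftQuasiRegular (c • x + a * x) := by
  change (x : Unitization ℂ A) ∈ Ring.jacobson (Unitization ℂ A) ↔ _
  rw [← Ideal.jacobson_bot, Ideal.mem_jacobson_iff]
  constructor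
  · intro h c a
    obtain ⟨z, hz⟩ := h (Unitization.inl c + (a : Unitization ℂ A))
    rw [Ideal.mem_bot, sub_eq_zero] at hz
    have h1 := congrArg (fun w => w.fst) hz
    have h2 := congrArg (fun w => w.snd) hz
    simp at h1 h2
    rw [h1] at h2
    refine ⟨z.snd, ?_⟩
    rw [← h2]
    simp only [one_mul, one_smul, mul_add, add_mul, mul_smul_comm, smul_mul_assoc, mul_assoc]
    abel
  · intro h y
    obtain ⟨z, hz⟩ := h y.fst y.snd
    refine ⟨1 + (z : Unitization ℂ A), ?_⟩
    rw [Ideal.mem_bot, sub_eq_zero]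
    ext
    · simp
    · simp
      rw [← hz]
      simp only [mul_add, add_mul, mul_smul_comm, smul_mul_assoc, mul_assoc]
      abel

theorem mem_jacobsonIdeal_of_isLeftIdeal {L : Submodule ℂ A} (hL : IsLeftIdeal L)
    (h : ∀ x ∈ L, IsLeftQuasiRegular x) {x : A} (hx : x ∈ L) : x ∈ jacobsonIdeal A :=
  mem_jacobsonIdeal_iff.mpr fun c a => h _ (L.add_mem (L.smul_mem c hx) (hL a x hx))

theorem map_mem_jacobsonIdeal {f : A →ₙₐ[ℂ] B} (hf : Function.Surjective f) {x : A}
    (hx : x ∈ jacobsonIdeal A) : f x ∈ jacobsonIdeal B := by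
  rw [mem_jacobsonIdeal_iff] at hx ⊢
  intro c b
  obtain ⟨a, rfl⟩ := hf b
  simpa using (hx c a).map f

theorem IsIdealEmbedding.mem_jacobsonIdeal {ι : A →ₙₐ[ℂ] B} (hι : IsIdealEmbedding ι) {x : A}
    (hx : ι x ∈ jacobsonIdeal B) : x ∈ jacobsonIdeal A := by
  rw [mem_jacobsonIdeal_iff] at hx ⊢
  intro c a
  obtain ⟨z, hz⟩ := hx c (ι a)
  obtain ⟨m, hm⟩ := hι.mul_left z (c • x + a * x)
  refine ⟨-(c • x + a * x) - m, hι.injective ?_⟩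
  -- The left quasi-inverse `z` lies in the ideal: `z = -u - z * u`.
  have hu : ι (c • x + a * x) = c • ι x + ι a * ι x := by simp
  rw [← hu] at hz
  have hz' : ι (-(c • x + a * x) - m) = z := by
    rw [map_sub, map_neg, hm, eq_comm, ← sub_eq_zero, ← hz]
    abel
  rw [map_add, map_mul, map_add, hz', hz, map_zero]

theorem IsIdealEmbedding.map_mem_jacobsonIdeal {ι : A →ₙₐ[ℂ] B} (hι : IsIdealEmbedding ι) {x : A}
    (hx : x ∈ jacobsonIdeal A) : ι x ∈ jacobsonIdeal B := by
  rw [mem_jacobsonIdeal_iff]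
  intro c b
  -- With `u = (c + b) x` in the ideal, `u * u = (c u + u b) x` is a left multiple of `x` there.
  obtain ⟨m, hm⟩ := hι.mul_left b x
  obtain ⟨n, hn⟩ := hι.mul_right (c • x + m) b
  apply isLeftQuasiRegular_of_neg_mul_self
  have h := ((mem_jacobsonIdeal_iff.mp hx 0 (-(c • (c • x + m) + n)))).map ι
  convert h using 1
  have hu : c • ι x + b * ι x = ι (c • x + m) := by simp [hm]
  rw [zero_smul, zero_add, map_mul, map_neg, map_add, hn, map_smul, ← hu]
  simp only [add_mul, mul_add, mul_smul_comm, smul_mul_assoc, mul_assoc, smul_add, neg_mul]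

/-- A left ideal with zero square consists of quasi-regular elements, so it vanishes in a
semisimple algebra. -/
theorem eq_zero_of_isLeftIdeal_of_mul_eq_zero (hA : jacobsonIdeal A = ⊥) {L : Submodule ℂ A}
    (hL : IsLeftIdeal L) (h : ∀ x ∈ L, ∀ y ∈ L, x * y = 0) {x : A} (hx : x ∈ L) : x = 0 := by
  rw [← AlgIdeal.mem_bot, ← hA]
  refine mem_jacobsonIdeal_of_isLeftIdeal hL (fun u hu => ⟨-u, ?_⟩) hx
  rw [neg_mul, h u hu u hu]
  simp

theorem exists_mul_ne_zero_of_isLeftIdeal (hA : jacobsonIdeal A = ⊥) {L : Submodule ℂ A}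
    (hL : IsLeftIdeal L) (h : L ≠ ⊥) : ∃ x ∈ L, ∃ y ∈ L, x * y ≠ 0 := by
  by_contra! H
  exact h ((Submodule.eq_bot_iff L).mpr
    fun x hx => eq_zero_of_isLeftIdeal_of_mul_eq_zero hA hL H hx)

theorem eq_zero_of_forall_mul_right_eq_zero (hA : jacobsonIdeal A = ⊥) {x : A}
    (h : ∀ y, x * y = 0) : x = 0 := by
  let L : Submodule ℂ A :=
    { carrier := {x | ∀ y, x * y = 0}
      add_mem' := fun {a b} ha hb y => by rw [add_mul, ha, hb, add_zero]
      zero_mem' := fun y => zero_mul y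
      smul_mem' := fun c a ha y => by rw [smul_mul_assoc, ha, smul_zero] }
  refine eq_zero_of_isLeftIdeal_of_mul_eq_zero (L := L) hA (fun a z hz y => ?_)
    (fun y hy z _ => hy z) h
  rw [mul_assoc, hz, mul_zero]

theorem eq_zero_of_forall_mul_left_eq_zero (hA : jacobsonIdeal A = ⊥) {x : A}
    (h : ∀ y, y * x = 0) : x = 0 := by
  let L : Submodule ℂ A :=
    { carrier := {x | ∀ y, y * x = 0}
      add_mem' := fun {a b} ha hb y => by rw [mul_add, ha, hb, add_zero]
      zero_mem' := fun y => mul_zero y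
      smul_mem' := fun c a ha y => by rw [mul_smul_comm, ha, smul_zero] }
  refine eq_zero_of_isLeftIdeal_of_mul_eq_zero (L := L) hA (fun a z hz y => ?_)
    (fun y _ z hz => hz y) h
  rw [← mul_assoc, hz]

end Hom

/-! ### Minimal left ideals of semisimple algebras -/

section MinimalLeftIdeal

set_option linter.unusedSectionVars false

variable {A : Type*} [NonUnitalRing A] [Module ℂ A] [IsScalarTower ℂ A A] [SMulCommClass ℂ A A]
variable {B : Type*} [NonUnitalRing B] [Module ℂ B] [IsScalarTower ℂ B B] [SMulCommClass ℂ B B]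

theorem IsMinimalLeftIdeal.eq_of_le {L M : Submodule ℂ A} (hL : IsMinimalLeftIdeal L)
    (hM : IsLeftIdeal M) (h0 : M ≠ ⊥) (hle : M ≤ L) : M = L :=
  le_antisymm hle (hL.le_of_le ⟨hM, h0⟩ hle)

theorem IsLeftIdeal.map_mulRight {L : Submodule ℂ A} (hL : IsLeftIdeal L) (a : A) :
    IsLeftIdeal (L.map (LinearMap.mulRight ℂ a)) := by
  rintro b _ ⟨x, hx, rfl⟩
  exact ⟨b * x, hL b x hx, by simp [mul_assoc]⟩

theorem IsLeftIdeal.map {f : A →ₙₐ[ℂ] B} (hf : Function.Surjective f) {L : Submodule ℂ A}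
    (hL : IsLeftIdeal L) : IsLeftIdeal (L.map (f : A →ₗ[ℂ] B)) := by
  rintro b _ ⟨x, hx, rfl⟩
  obtain ⟨a, rfl⟩ := hf b
  exact ⟨a * x, hL a x hx, map_mul f a x⟩

theorem IsLeftIdeal.comap (f : A →ₙₐ[ℂ] B) {L : Submodule ℂ B}
    (hL : IsLeftIdeal L) : IsLeftIdeal (L.comap (f : A →ₗ[ℂ] B)) := by
  intro a x hx
  have : f (a * x) ∈ L := by rw [map_mul]; exact hL _ _ hx
  exact this

theorem IsLeftIdeal.inf {L M : Submodule ℂ A} (hL : IsLeftIdeal L) (hM : IsLeftIdeal M) :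
    IsLeftIdeal (L ⊓ M) := fun a x hx => ⟨hL a x hx.1, hM a x hx.2⟩

theorem isLeftIdeal_range_mulRight (a : A) :
    IsLeftIdeal (LinearMap.range (LinearMap.mulRight ℂ a)) := by
  rintro b _ ⟨x, rfl⟩
  exact ⟨b * x, by simp [mul_assoc]⟩

theorem isLeftIdeal_ker_mulRight (a : A) :
    IsLeftIdeal (LinearMap.ker (LinearMap.mulRight ℂ a)) := by
  intro b x hx
  have hx : x * a = 0 := hx
  change b * x * a = 0
  rw [mul_assoc, hx, mul_zero]

/-- A minimal left ideal of a semisimple algebra is of the form `L y` with `y ∈ L`. -/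
theorem IsMinimalLeftIdeal.exists_map_mulRight_eq (hA : jacobsonIdeal A = ⊥) {L : Submodule ℂ A}
    (hL : IsMinimalLeftIdeal L) : ∃ y ∈ L, L.map (LinearMap.mulRight ℂ y) = L := by
  obtain ⟨x, hx, y, hy, hxy⟩ := exists_mul_ne_zero_of_isLeftIdeal hA hL.prop.1 hL.prop.2
  refine ⟨y, hy, hL.eq_of_le (hL.prop.1.map_mulRight y) ?_ ?_⟩
  · exact (Submodule.ne_bot_iff _).mpr ⟨x * y, ⟨x, hx, rfl⟩, hxy⟩
  · rintro _ ⟨z, -, rfl⟩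
    exact hL.prop.1 z y hy

/-- The image of a minimal left ideal under a surjective homomorphism is minimal or zero. -/
theorem IsMinimalLeftIdeal.map {f : A →ₙₐ[ℂ] B} (hf : Function.Surjective f) {L : Submodule ℂ A}
    (hL : IsMinimalLeftIdeal L) (h : L.map (f : A →ₗ[ℂ] B) ≠ ⊥) :
    IsMinimalLeftIdeal (L.map (f : A →ₗ[ℂ] B)) := by
  refine ⟨⟨hL.prop.1.map hf, h⟩, ?_⟩
  rintro M ⟨hM, hM0⟩ hML
  have hN : L ⊓ M.comap (f : A →ₗ[ℂ] B) = L := by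
    refine hL.eq_of_le (hL.prop.1.inf (hM.comap f)) ?_ inf_le_left
    obtain ⟨y, hy, hy0⟩ := (Submodule.ne_bot_iff _).mp hM0
    obtain ⟨x, hx, rfl⟩ := hML hy
    exact (Submodule.ne_bot_iff _).mpr ⟨x, ⟨hx, hy⟩, fun h0 => hy0 (by rw [h0, map_zero])⟩
  rw [Submodule.map_le_iff_le_comap]
  exact inf_eq_left.mp hN

/-! ### Algebras with zero presocle -/

variable (A) in
/-- The algebra `A` has zero presocle: it is semisimple and has no minimal left ideals. -/
structure HasZeroPresocle : Prop where
  jacobsonIdeal_eq_bot : jacobsonIdeal A = ⊥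
  not_isMinimalLeftIdeal : ∀ L : Submodule ℂ A, ¬ IsMinimalLeftIdeal L

theorem HasZeroPresocle.presocle_le_ker {f : A →ₙₐ[ℂ] B} (hf : Function.Surjective f)
    (hB : HasZeroPresocle B) : presocle A ≤ AlgIdeal.ker f := by
  have hle : jacobsonIdeal A ≤ AlgIdeal.ker f := fun x hx => by
    have := map_mem_jacobsonIdeal hf hx
    rwa [hB.jacobsonIdeal_eq_bot] at this
  let g := (jacobsonIdeal A).lift f hle
  have hg : Function.Surjective g := (jacobsonIdeal A).lift_surjective hle hf
  have hsoc : (socle (jacobsonIdeal A).Quot).toSubmodule ≤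
      LinearMap.ker (g : (jacobsonIdeal A).Quot →ₗ[ℂ] B) :=
    sSup_le fun L (hL : IsMinimalLeftIdeal L) => by
      by_contra hne
      refine hB.not_isMinimalLeftIdeal _ (hL.map hg fun h0 => hne ?_)
      rwa [LinearMap.le_ker_iff_map]
  exact fun x hx => hsoc hx

theorem presocle_eq_bot_iff : presocle A = ⊥ ↔ HasZeroPresocle A := by
  constructor
  · intro h
    have hrad : jacobsonIdeal A = ⊥ := by
      rw [← AlgIdeal.le_bot_iff, ← h]
      intro x hx
      have h0 : (jacobsonIdeal A).quotMap x = 0 := AlgIdeal.quotMap_eq_zero.mpr hx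
      rw [presocle, AlgIdeal.mem_preimage, h0]
      exact (socle (jacobsonIdeal A).Quot).zero_mem
    refine ⟨hrad, fun L hL => ?_⟩
    obtain ⟨x, hx, hx0⟩ := (Submodule.ne_bot_iff _).mp hL.prop.2
    have hxq : (jacobsonIdeal A).quotMap x ≠ 0 := by
      rwa [Ne, AlgIdeal.quotMap_eq_zero, hrad, AlgIdeal.mem_bot]
    have hmem : (jacobsonIdeal A).quotMap x ∈
        L.map ((jacobsonIdeal A).quotMap : A →ₗ[ℂ] (jacobsonIdeal A).Quot) := ⟨x, hx, rfl⟩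
    have hmin := hL.map (jacobsonIdeal A).quotMap_surjective
      ((Submodule.ne_bot_iff _).mpr ⟨_, hmem, hxq⟩)
    have : x ∈ presocle A := (le_sSup hmin :
      _ ≤ sSup {L : Submodule ℂ (jacobsonIdeal A).Quot | IsMinimalLeftIdeal L}) hmem
    rw [h] at this
    exact hx0 this
  · intro h
    rw [← AlgIdeal.le_bot_iff]
    exact h.presocle_le_ker (f := NonUnitalAlgHom.id ℂ A) Function.surjective_id

theorem HasZeroPresocle.of_idealEmbedding {ι : A →ₙₐ[ℂ] B} (hι : IsIdealEmbedding ι)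
    (hB : HasZeroPresocle B) : HasZeroPresocle A := by
  have hrad : jacobsonIdeal A = ⊥ := by
    rw [← AlgIdeal.le_bot_iff]
    intro x hx
    have := hι.map_mem_jacobsonIdeal hx
    rw [hB.jacobsonIdeal_eq_bot] at this
    exact hι.eq_zero this
  refine ⟨hrad, fun L hL => ?_⟩
  obtain ⟨y, hy, hLy⟩ := hL.exists_map_mulRight_eq hrad
  -- As `L = L y`, the left ideal `L` of the ideal is also a left ideal of the whole algebra.
  refine hB.not_isMinimalLeftIdeal (L.map (ι : A →ₗ[ℂ] B)) ⟨⟨?_, ?_⟩, ?_⟩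
  · rintro b _ ⟨l, hl, rfl⟩
    rw [← hLy] at hl
    obtain ⟨z, -, rfl⟩ := hl
    obtain ⟨m, hm⟩ := hι.mul_left b z
    refine ⟨m * y, hL.prop.1 m y hy, ?_⟩
    change ι (m * y) = b * ι (z * y)
    rw [map_mul, map_mul, hm, mul_assoc]
  · obtain ⟨x, hx, hx0⟩ := (Submodule.ne_bot_iff _).mp hL.prop.2
    exact (Submodule.ne_bot_iff _).mpr ⟨ι x, ⟨x, hx, rfl⟩, fun h => hx0 (hι.eq_zero h)⟩
  · rintro M ⟨hM, hM0⟩ hML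
    rw [Submodule.map_le_iff_le_comap]
    refine hL.le_of_le ⟨hM.comap ι, ?_⟩ ?_
    · obtain ⟨x, hx, hx0⟩ := (Submodule.ne_bot_iff _).mp hM0
      obtain ⟨l, hl, rfl⟩ := hML hx
      exact (Submodule.ne_bot_iff _).mpr ⟨l, hx, fun h => hx0 (by rw [h, map_zero])⟩
    · intro x hx
      obtain ⟨l, hl, hlx⟩ := hML hx
      rwa [← hι.injective hlx]

/-- An algebra has zero presocle as soon as some ideal with zero right annihilator does. -/
theorem HasZeroPresocle.of_essential {ι : A →ₙₐ[ℂ] B} (hι : IsIdealEmbedding ι)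
    (hess : ∀ b, (∀ n, ι n * b = 0) → b = 0) (hA : HasZeroPresocle A) : HasZeroPresocle B := by
  have hrad : jacobsonIdeal B = ⊥ := by
    rw [← AlgIdeal.le_bot_iff]
    refine fun x hx => hess x fun n => ?_
    obtain ⟨m, hm⟩ := hι.mul_right n x
    have hmem : ι m ∈ jacobsonIdeal B := by
      rw [hm]
      exact (jacobsonIdeal B).mul_left_mem _ hx
    have := hι.mem_jacobsonIdeal hmem
    rw [hA.jacobsonIdeal_eq_bot, AlgIdeal.mem_bot] at this
    rw [← hm, this, map_zero]
  refine ⟨hrad, fun L hL => hA.not_isMinimalLeftIdeal (L.comap (ι : A →ₗ[ℂ] B))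
    ⟨⟨hL.prop.1.comap ι, ?_⟩, ?_⟩⟩
  · obtain ⟨l, hl, hl0⟩ := (Submodule.ne_bot_iff _).mp hL.prop.2
    obtain ⟨n, hn⟩ := not_forall.mp (mt (hess l) hl0)
    obtain ⟨m, hm⟩ := hι.mul_right n l
    refine (Submodule.ne_bot_iff _).mpr ⟨m, ?_, fun h => hn (by rw [← hm, h, map_zero])⟩
    change ι m ∈ L
    rw [hm]
    exact hL.prop.1 _ _ hl
  · rintro M ⟨hM, hM0⟩ hML
    obtain ⟨x, hx, y, hy, hxy⟩ := exists_mul_ne_zero_of_isLeftIdeal hA.jacobsonIdeal_eq_bot hM hM0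
    -- The image of `A y` is a left ideal of `B` inside `L`, hence equal to `L`.
    let P : Submodule ℂ B :=
      (LinearMap.range (ι : A →ₗ[ℂ] B)).map (LinearMap.mulRight ℂ (ι y))
    have hP : P = L := by
      refine hL.eq_of_le ?_ ?_ ?_
      · rintro b _ ⟨_, ⟨n, rfl⟩, rfl⟩
        obtain ⟨m, hm⟩ := hι.mul_left b n
        refine ⟨ι m, ⟨m, rfl⟩, ?_⟩
        change ι m * ι y = b * (ι n * ι y)
        rw [hm, mul_assoc]
      · refine (Submodule.ne_bot_iff _).mpr ⟨ι x * ι y, ⟨ι x, ⟨x, rfl⟩, rfl⟩, fun h => hxy ?_⟩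
        rw [← map_mul] at h
        exact hι.eq_zero h
      · rintro _ ⟨_, ⟨n, rfl⟩, rfl⟩
        exact hL.prop.1 _ _ (hML hy)
    intro z hz
    have hz : ι z ∈ L := hz
    rw [← hP] at hz
    obtain ⟨_, ⟨n, rfl⟩, hn⟩ := hz
    have hn : ι n * ι y = ι z := hn
    rw [← map_mul] at hn
    rw [← hι.injective hn]
    exact hM n y hy

/-- A non-zero finite rank element `v` of a semisimple algebra yields a minimal left ideal:
among the non-zero left ideals `K ⊆ A v` take one for which `v K ⊆ v A v` has least dimension. Then
`K * K` lies in every non-zero left ideal contained in `K`. -/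
theorem exists_isMinimalLeftIdeal_of_isFiniteRankElement (hA : jacobsonIdeal A = ⊥) {v : A}
    (hv0 : v ≠ 0) (hv : IsFiniteRankElement A v) : ∃ L : Submodule ℂ A, IsMinimalLeftIdeal L := by
  let S : Set (Submodule ℂ A) :=
    {K | IsLeftIdeal K ∧ K ≠ ⊥ ∧ K ≤ LinearMap.range (LinearMap.mulRight ℂ v)}
  let φ : Submodule ℂ A → ℕ := fun K => Module.finrank ℂ (K.map (LinearMap.mulLeft ℂ v))
  have hS : S.Nonempty := by
    refine ⟨_, isLeftIdeal_range_mulRight v, fun h => hv0 ?_, le_rfl⟩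
    refine eq_zero_of_forall_mul_left_eq_zero hA fun y => ?_
    have : y * v ∈ LinearMap.range (LinearMap.mulRight ℂ v) := ⟨y, rfl⟩
    rwa [h] at this
  obtain ⟨K, hK, hKmin⟩ : ∃ K ∈ S, ∀ K' ∈ S, φ K ≤ φ K' :=
    ⟨Function.argminOn φ S hS, Function.argminOn_mem φ S hS,
      fun K' hK' => Function.argminOn_le φ S hK'⟩
  obtain ⟨hKl, hK0, hKv⟩ := hK
  have hfin : FiniteDimensional ℂ (K.map (LinearMap.mulLeft ℂ v)) := by
    have : FiniteDimensional ℂ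
      (LinearMap.range (LinearMap.mulLeft ℂ v ∘ₗ LinearMap.mulRight ℂ v)) := hv
    refine Submodule.finiteDimensional_of_le (S₂ := LinearMap.range
      (LinearMap.mulLeft ℂ v ∘ₗ LinearMap.mulRight ℂ v)) ?_
    rw [LinearMap.range_comp]
    exact Submodule.map_mono hKv
  -- Every non-zero left ideal `K' ≤ K` contains `K * K`, as `v K' = v K` and `K ⊆ A v`.
  have key : ∀ K' : Submodule ℂ A, IsLeftIdeal K' → K' ≠ ⊥ → K' ≤ K →
      ∀ x ∈ K, ∀ k ∈ K, x * k ∈ K' := by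
    intro K' hK' hK'0 hle x hx k hk
    have heq : K'.map (LinearMap.mulLeft ℂ v) = K.map (LinearMap.mulLeft ℂ v) :=
      Submodule.eq_of_le_of_finrank_le (Submodule.map_mono hle)
        (hKmin K' ⟨hK', hK'0, hle.trans hKv⟩)
    obtain ⟨x', rfl⟩ := hKv hx
    have hvk : v * k ∈ K.map (LinearMap.mulLeft ℂ v) := ⟨k, hk, rfl⟩
    rw [← heq] at hvk
    obtain ⟨k', hk', hvk'⟩ := hvk
    have hvk' : v * k' = v * k := hvk'
    change x' * v * k ∈ K'
    rw [mul_assoc, ← hvk', ← mul_assoc]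
    exact hK' _ _ hk'
  obtain ⟨x, hx, y, hy, hxy⟩ := exists_mul_ne_zero_of_isLeftIdeal hA hKl hK0
  have hKy : K.map (LinearMap.mulRight ℂ y) ≤ K := by
    rintro _ ⟨z, -, rfl⟩
    exact hKl z y hy
  refine ⟨K.map (LinearMap.mulRight ℂ y), ⟨hKl.map_mulRight y, ?_⟩, ?_⟩
  · exact (Submodule.ne_bot_iff _).mpr ⟨x * y, ⟨x, hx, rfl⟩, hxy⟩
  · rintro M ⟨hM, hM0⟩ hMle
    rintro _ ⟨z, hz, rfl⟩
    exact key M hM hM0 (hMle.trans hKy) z hz y hy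

end MinimalLeftIdeal

/-! ### The ideal generated by the presocle -/

/-- An increasing transfinite chain in a small type is stationary at some ordinal. -/
theorem exists_eq_add_one_of_chain {α : Type u} [PartialOrder α] (f : Ordinal.{u} → α)
    (hsucc : ∀ o, f o ≤ f (o + 1))
    (hlim : ∀ o, Order.IsSuccLimit o → ∀ γ < o, f γ ≤ f o) : ∃ o, f o = f (o + 1) := by
  have hmono : ∀ β γ, γ ≤ β → f γ ≤ f β := by
    intro β
    induction β using Ordinal.limitRecOn with
    | zero => intro γ hγ; rw [nonpos_iff_eq_zero.mp hγ]
    | add_one o ih =>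
      intro γ hγ
      rcases hγ.eq_or_lt with rfl | hlt
      · exact le_rfl
      · exact (ih γ (Order.lt_add_one_iff.mp hlt)).trans (hsucc o)
    | limit o ho _ =>
      intro γ hγ
      rcases hγ.eq_or_lt with rfl | hlt
      · exact le_rfl
      · exact hlim o ho γ hlt
  obtain ⟨β, γ, h, hne⟩ : ∃ β γ, f β = f γ ∧ β < γ := by
    have := not_injective_of_ordinal f
    rw [Function.Injective] at this
    push Not at this
    obtain ⟨β, γ, h, hne⟩ := this
    rcases hne.lt_or_gt with hlt | hlt
    · exact ⟨β, γ, h, hlt⟩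
    · exact ⟨γ, β, h.symm, hlt⟩
  exact ⟨β, le_antisymm (hsucc β) ((hmono γ _ (Order.add_one_le_of_lt hne)).trans h.ge)⟩

section PresocleStar

set_option linter.unusedSectionVars false

variable {A : Type u} [NonUnitalRing A] [Module ℂ A] [IsScalarTower ℂ A A] [SMulCommClass ℂ A A]
variable {B : Type u} [NonUnitalRing B] [Module ℂ B] [IsScalarTower ℂ B B] [SMulCommClass ℂ B B]

theorem AlgIdeal.le_preimage (I : AlgIdeal A) (J : AlgIdeal I.Quot) : I ≤ I.preimage J := by
  intro x hx
  rw [AlgIdeal.mem_preimage, AlgIdeal.quotMap_eq_zero.mpr hx]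
  exact J.zero_mem

theorem AlgIdeal.eq_bot_of_preimage_le {I : AlgIdeal A} {J : AlgIdeal I.Quot}
    (h : I.preimage J ≤ I) : J = ⊥ := by
  rw [← AlgIdeal.le_bot_iff]
  intro x hx
  obtain ⟨a, rfl⟩ := I.quotMap_surjective x
  exact AlgIdeal.quotMap_eq_zero.mpr (h hx)

variable (A) in
theorem presocleChain_zero : presocleChain A 0 = ⊥ := Ordinal.limitRecOn_zero ..

variable (A) in
theorem presocleChain_add_one (o : Ordinal.{u}) :
    presocleChain A (o + 1) = (presocleChain A o).preimage (presocle (presocleChain A o).Quot) :=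
  Ordinal.limitRecOn_add_one ..

variable (A) in
theorem presocleChain_limit {o : Ordinal.{u}} (ho : Order.IsSuccLimit o) :
    presocleChain A o = AlgIdeal.iSup fun γ : Set.Iio o => presocleChain A γ.1 :=
  Ordinal.limitRecOn_limit _ _ _ _ ho

theorem presocleStar_le_ker {f : A →ₙₐ[ℂ] B} (hf : Function.Surjective f)
    (hB : HasZeroPresocle B) : presocleStar A ≤ AlgIdeal.ker f := by
  refine AlgIdeal.iSup_le fun o => ?_
  induction o using Ordinal.limitRecOn with
  | zero => rw [presocleChain_zero]; exact AlgIdeal.bot_le _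
  | add_one o ih =>
    rw [presocleChain_add_one]
    intro x hx
    exact hB.presocle_le_ker ((presocleChain A o).lift_surjective ih hf) hx
  | limit o ho ih =>
    rw [presocleChain_limit A ho]
    exact AlgIdeal.iSup_le fun γ => ih γ.1 γ.2

variable (A) in
/-- Together with `presocleStar_le_ker` this characterises `psoc* A` as the smallest ideal modulo
which the presocle vanishes. -/
theorem hasZeroPresocle_quot_presocleStar : HasZeroPresocle (presocleStar A).Quot := by
  obtain ⟨o, ho⟩ := exists_eq_add_one_of_chain (presocleChain A)
    (fun o => by rw [presocleChain_add_one]; exact AlgIdeal.le_preimage _ _)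
    (fun o ho γ hγ => by
      rw [presocleChain_limit A ho]
      exact AlgIdeal.le_iSup (fun γ : Set.Iio o => presocleChain A γ.1) ⟨γ, hγ⟩)
  rw [presocleChain_add_one] at ho
  have h0 : HasZeroPresocle (presocleChain A o).Quot :=
    presocle_eq_bot_iff.mp (AlgIdeal.eq_bot_of_preimage_le ho.ge)
  have heq : presocleStar A = presocleChain A o := by
    refine le_antisymm (fun x hx => ?_) (AlgIdeal.le_iSup (presocleChain A) o)
    exact AlgIdeal.quotMap_eq_zero.mp
      (presocleStar_le_ker (presocleChain A o).quotMap_surjective h0 hx)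
  rwa [heq]

theorem presocleStar_le {K : AlgIdeal A} (h : HasZeroPresocle K.Quot) : presocleStar A ≤ K :=
  fun _ hx => AlgIdeal.quotMap_eq_zero.mp (presocleStar_le_ker K.quotMap_surjective h hx)

theorem map_mem_presocleStar {f : A →ₙₐ[ℂ] B} (hf : Function.Surjective f) {x : A}
    (hx : x ∈ presocleStar A) : f x ∈ presocleStar B :=
  AlgIdeal.quotMap_eq_zero.mp <| presocleStar_le_ker (f := (presocleStar B).quotMap.comp f)
    ((presocleStar B).quotMap_surjective.comp hf) (hasZeroPresocle_quot_presocleStar B) hx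

variable (A) in
theorem presocleStar_quot : presocleStar (presocleStar A).Quot = ⊥ :=
  AlgIdeal.le_bot_iff.mp
    (presocleStar_le_ker (f := NonUnitalAlgHom.id ℂ _) Function.surjective_id
      (hasZeroPresocle_quot_presocleStar A))

variable (A) in
theorem jacobsonIdeal_le_presocleStar : jacobsonIdeal A ≤ presocleStar A := by
  intro x hx
  have := map_mem_jacobsonIdeal (presocleStar A).quotMap_surjective hx
  rw [(hasZeroPresocle_quot_presocleStar A).jacobsonIdeal_eq_bot] at this
  exact AlgIdeal.quotMap_eq_zero.mp this

/-! ### Heredity -/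

theorem coe_mem_presocleStar (I : AlgIdeal A) {x : I.toSubalg}
    (hx : x ∈ presocleStar I.toSubalg) : (x : A) ∈ presocleStar A := by
  let q := (presocleStar A).quotMap
  let φ : I.toSubalg →ₙₐ[ℂ] (presocleStar A).Quot := q.comp I.incl
  let ι := (AlgIdeal.ker φ).lift φ le_rfl
  -- `I / (I ∩ psoc* A)` is an ideal of `A / psoc* A`.
  have hι : IsIdealEmbedding ι := by
    refine ⟨?_, ?_, ?_⟩
    · rw [injective_iff_map_eq_zero]
      intro y hy
      obtain ⟨y, rfl⟩ := (AlgIdeal.ker φ).quotMap_surjective y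
      exact AlgIdeal.quotMap_eq_zero.mpr hy
    · intro b n
      obtain ⟨b, rfl⟩ := (presocleStar A).quotMap_surjective b
      obtain ⟨n, rfl⟩ := (AlgIdeal.ker φ).quotMap_surjective n
      exact ⟨(AlgIdeal.ker φ).quotMap ⟨b * n, I.mul_left_mem b n.2⟩, map_mul q b n⟩
    · intro n b
      obtain ⟨b, rfl⟩ := (presocleStar A).quotMap_surjective b
      obtain ⟨n, rfl⟩ := (AlgIdeal.ker φ).quotMap_surjective n
      exact ⟨(AlgIdeal.ker φ).quotMap ⟨n * b, I.mul_right_mem b n.2⟩, map_mul q (n : A) b⟩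
  have := presocleStar_le (.of_idealEmbedding hι (hasZeroPresocle_quot_presocleStar A)) hx
  exact AlgIdeal.quotMap_eq_zero.mp this

/-- The inclusion into `A` of an ideal `K` of an ideal `I` of `A` with `I / K` semisimple. It is
an ideal of `A`, because the annihilators of `I / K` in itself vanish. -/
def AlgIdeal.ofQuotSemisimple (I : AlgIdeal A) (K : AlgIdeal I.toSubalg)
    (hK : jacobsonIdeal K.Quot = ⊥) : AlgIdeal A where
  toSubmodule := K.toSubmodule.map (I.incl : I.toSubalg →ₗ[ℂ] A)
  mul_left_mem := by
    rintro a _ ⟨x, hx, rfl⟩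
    refine ⟨⟨a * x, I.mul_left_mem a x.2⟩, ?_, rfl⟩
    refine AlgIdeal.quotMap_eq_zero.mp (eq_zero_of_forall_mul_left_eq_zero hK fun y => ?_)
    obtain ⟨y, rfl⟩ := K.quotMap_surjective y
    rw [← map_mul]
    refine AlgIdeal.quotMap_eq_zero.mpr ?_
    have : y * ⟨a * x, I.mul_left_mem a x.2⟩ = ⟨y * a, I.mul_right_mem a y.2⟩ * x :=
      Subtype.ext (mul_assoc (y : A) a x).symm
    rw [this]
    exact K.mul_left_mem _ hx
  mul_right_mem := by
    rintro _ a ⟨x, hx, rfl⟩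
    refine ⟨⟨x * a, I.mul_right_mem a x.2⟩, ?_, rfl⟩
    refine AlgIdeal.quotMap_eq_zero.mp (eq_zero_of_forall_mul_right_eq_zero hK fun y => ?_)
    obtain ⟨y, rfl⟩ := K.quotMap_surjective y
    rw [← map_mul]
    refine AlgIdeal.quotMap_eq_zero.mpr ?_
    have : ⟨x * a, I.mul_right_mem a x.2⟩ * y = x * ⟨a * y, I.mul_left_mem a y.2⟩ :=
      Subtype.ext (mul_assoc (x : A) a y)
    rw [this]
    exact K.mul_right_mem _ hx

theorem AlgIdeal.coe_mem_ofQuotSemisimple {I : AlgIdeal A} {K : AlgIdeal I.toSubalg}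
    {hK : jacobsonIdeal K.Quot = ⊥} {x : I.toSubalg} :
    (x : A) ∈ I.ofQuotSemisimple K hK ↔ x ∈ K := by
  constructor
  · rintro ⟨y, hy, h⟩
    rwa [← show y = x from Subtype.ext h]
  · exact fun h => ⟨x, h, rfl⟩

/-- For an ideal `K`, the ideal of all `x` with `I x ⊆ K`. -/
def AlgIdeal.rightTransporter (I K : AlgIdeal A) : AlgIdeal A where
  carrier := {x | ∀ y ∈ I, y * x ∈ K}
  add_mem' := fun {a b} ha hb y hy => by rw [mul_add]; exact K.add_mem (ha y hy) (hb y hy)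
  zero_mem' := fun y _ => by rw [mul_zero]; exact K.zero_mem
  smul_mem' := fun c x hx y hy => by rw [mul_smul_comm]; exact K.smul_mem c (hx y hy)
  mul_left_mem := fun a x hx y hy => by
    rw [← mul_assoc]
    exact hx _ (I.mul_right_mem a hy)
  mul_right_mem := fun {x} a hx y hy => by
    rw [← mul_assoc]
    exact K.mul_right_mem a (hx y hy)

/-- With `K = psoc* I`, an ideal of `A`, and `Z = {x | I x ⊆ K}`, the algebra `I / K` is an ideal
of `A / Z` with zero right annihilator. Hence `A / Z` has zero presocle and `psoc* A ⊆ Z`. -/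
theorem mem_presocleStar_of_coe_mem (I : AlgIdeal A) {x : I.toSubalg}
    (hx : (x : A) ∈ presocleStar A) : x ∈ presocleStar I.toSubalg := by
  set K := presocleStar I.toSubalg with hKdef
  have hKz : HasZeroPresocle K.Quot := hasZeroPresocle_quot_presocleStar _
  have hK := hKz.jacobsonIdeal_eq_bot
  let K' := I.ofQuotSemisimple K hK
  let Z := I.rightTransporter K'
  have hmem : ∀ z : I.toSubalg, (z : A) ∈ Z ↔ z ∈ K := by
    intro z
    constructor
    · intro hz
      refine AlgIdeal.quotMap_eq_zero.mp (eq_zero_of_forall_mul_left_eq_zero hK fun y => ?_)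
      obtain ⟨y, rfl⟩ := K.quotMap_surjective y
      rw [← map_mul]
      exact AlgIdeal.quotMap_eq_zero.mpr (AlgIdeal.coe_mem_ofQuotSemisimple.mp (hz y y.2))
    · intro hz y _
      exact K'.mul_left_mem y (AlgIdeal.coe_mem_ofQuotSemisimple.mpr hz)
  let φ : I.toSubalg →ₙₐ[ℂ] Z.Quot := Z.quotMap.comp I.incl
  let ι := K.lift φ fun z hz => AlgIdeal.quotMap_eq_zero.mpr ((hmem z).mpr hz)
  have hι : IsIdealEmbedding ι := by
    refine ⟨?_, ?_, ?_⟩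
    · rw [injective_iff_map_eq_zero]
      intro y hy
      obtain ⟨y, rfl⟩ := K.quotMap_surjective y
      exact AlgIdeal.quotMap_eq_zero.mpr ((hmem y).mp (AlgIdeal.quotMap_eq_zero.mp hy))
    · intro b n
      obtain ⟨b, rfl⟩ := Z.quotMap_surjective b
      obtain ⟨n, rfl⟩ := K.quotMap_surjective n
      exact ⟨K.quotMap ⟨b * n, I.mul_left_mem b n.2⟩, map_mul Z.quotMap b n⟩
    · intro n b
      obtain ⟨b, rfl⟩ := Z.quotMap_surjective b
      obtain ⟨n, rfl⟩ := K.quotMap_surjective n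
      exact ⟨K.quotMap ⟨n * b, I.mul_right_mem b n.2⟩, map_mul Z.quotMap (n : A) b⟩
  have hZ : HasZeroPresocle Z.Quot := by
    refine hKz.of_essential hι fun b hb => ?_
    obtain ⟨b, rfl⟩ := Z.quotMap_surjective b
    refine AlgIdeal.quotMap_eq_zero.mpr fun y hy => ?_
    have h1 := hb (K.quotMap ⟨y, hy⟩)
    have h2 : y * b ∈ Z := AlgIdeal.quotMap_eq_zero.mp ((map_mul Z.quotMap y b).trans h1)
    exact AlgIdeal.coe_mem_ofQuotSemisimple.mpr ((hmem ⟨y * b, I.mul_right_mem b hy⟩).mp h2)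
  exact (hmem x).mp (presocleStar_le hZ hx)

end PresocleStar

section Banach

set_option linter.unusedSectionVars false

variable {A : Type u} [NonUnitalNormedRing A] [NormedSpace ℂ A] [IsScalarTower ℂ A A]
  [SMulCommClass ℂ A A]

/-! ### The scattered radical is closed -/

/-- Multiplication by `u` on the left, as a bounded operator. -/
noncomputable def mulLeftL (u : A) : A →L[ℂ] A := ContinuousLinearMap.mul ℂ A u

/-- Multiplication by `u` on the right, as a bounded operator. -/
noncomputable def mulRightL (u : A) : A →L[ℂ] A := (ContinuousLinearMap.mul ℂ A).flip u

@[simp]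
theorem mulLeftL_apply (u x : A) : mulLeftL u x = u * x := rfl

@[simp]
theorem mulRightL_apply (u x : A) : mulRightL u x = x * u := rfl

theorem norm_mulRightL_le (u : A) : ‖mulRightL u‖ ≤ ‖u‖ :=
  ContinuousLinearMap.opNorm_le_bound _ (norm_nonneg u) fun x => by
    rw [mulRightL_apply, mul_comm ‖u‖]
    exact norm_mul_le x u

theorem isLeftQuasiRegular_of_norm_lt_one [CompleteSpace A] {u : A} (hu : ‖u‖ < 1) :
    IsLeftQuasiRegular u := by
  have hlt : ‖-mulRightL u‖ < 1 := by
    rw [norm_neg]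
    exact (norm_mulRightL_le u).trans_lt hu
  have hunit := isUnit_one_sub_of_norm_lt_one hlt
  obtain ⟨z, hz⟩ := (ContinuousLinearMap.isUnit_iff_bijective.mp hunit).2 (-u)
  refine ⟨z, ?_⟩
  have hz : z - -(z * u) = -u := hz
  rw [sub_neg_eq_add] at hz
  rw [add_right_comm, hz, neg_add_cancel]

/-- Every element of the closure of `J` becomes quasi-regular modulo `J`. -/
theorem AlgIdeal.isClosed_of_jacobsonIdeal_quot_eq_bot [CompleteSpace A] (J : AlgIdeal A)
    (h : jacobsonIdeal J.Quot = ⊥) : IsClosed (J : Set A) := by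
  refine isClosed_of_closure_subset fun x hx => ?_
  have hx : x ∈ J.closure.toAlgIdeal := hx
  refine AlgIdeal.quotMap_eq_zero.mp ?_
  rw [← AlgIdeal.mem_bot, ← h, mem_jacobsonIdeal_iff]
  intro c b
  obtain ⟨a, rfl⟩ := J.quotMap_surjective b
  rw [← map_smul, ← map_mul, ← map_add]
  have hu : c • x + a * x ∈ J.closure.toAlgIdeal :=
    J.closure.add_mem (J.closure.smul_mem c hx) (J.closure.mul_left_mem a hx)
  have hu' : c • x + a * x ∈ _root_.closure (J : Set A) := hu
  obtain ⟨j, hj, hjd⟩ := Metric.mem_closure_iff.mp hu' 1 one_pos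
  rw [dist_eq_norm] at hjd
  have := (isLeftQuasiRegular_of_norm_lt_one hjd).map J.quotMap
  rwa [map_sub, AlgIdeal.quotMap_eq_zero.mpr hj, sub_zero] at this

variable (A) in
theorem isClosed_presocleStar [CompleteSpace A] : IsClosed (presocleStar A : Set A) :=
  AlgIdeal.isClosed_of_jacobsonIdeal_quot_eq_bot _
    (hasZeroPresocle_quot_presocleStar A).jacobsonIdeal_eq_bot

theorem AlgIdeal.closure_le {I J : AlgIdeal A} (hJ : IsClosed (J : Set A)) (h : I ≤ J) :
    I.closure.toAlgIdeal ≤ J := fun _ hx => closure_minimal (show (I : Set A) ⊆ J from h) hJ hx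

theorem AlgIdeal.le_closure (I : AlgIdeal A) : I ≤ I.closure.toAlgIdeal :=
  fun _ hx => subset_closure (s := (I : Set A)) hx

/-! ### Compact elements -/

theorem IsCompactMulElement.smul_add_mul {a : A} (ha : IsCompactMulElement a) (c : ℂ) (b : A) :
    IsCompactMulElement (c • a + b * a) := by
  let P : A →L[ℂ] A := c • ContinuousLinearMap.id ℂ A + mulRightL b
  let Q : A →L[ℂ] A := c • ContinuousLinearMap.id ℂ A + mulLeftL b
  have h := (IsCompactOperator.comp_clm (f := fun x : A => a * x * a) ha P).clm_comp Q
  have heq : (fun x : A => (c • a + b * a) * x * (c • a + b * a)) =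
      Q ∘ (fun x : A => a * x * a) ∘ P := by
    funext x
    simp only [P, Q, Function.comp_apply, add_apply,
      smul_apply, ContinuousLinearMap.id_apply, mulLeftL_apply,
      mulRightL_apply, mul_add, add_mul, smul_mul_assoc, mul_smul_comm, smul_add, mul_assoc]
    abel
  rw [IsCompactMulElement, heq]
  exact h

/-- If `x ↦ x - c x c` is bijective then `1 + c` is left invertible. For the solution `x` of
`x - c x c = c * c - c`, both `c x` and `x c` solve the same equation, so `x` commutes with `c`, and
then `(1 + x) (1 + c) = 1` because `d = (1 + x) (1 + c) - 1` satisfies `d (1 - c) = 0`. -/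
theorem isLeftQuasiRegular_of_bijective {c : A}
    (h : Function.Bijective fun x : A => x - c * x * c) : IsLeftQuasiRegular c := by
  obtain ⟨x, hx⟩ := h.2 (c * c - c)
  have hx : x - c * x * c = c * c - c := hx
  have hcomm : c * x = x * c := by
    apply h.1
    change c * x - c * (c * x) * c = x * c - c * (x * c) * c
    rw [show c * x - c * (c * x) * c = c * (x - c * x * c) by noncomm_ring,
      show x * c - c * (x * c) * c = (x - c * x * c) * c by noncomm_ring, hx]
    noncomm_ring
  refine ⟨x, ?_⟩
  set d := x + c + x * c with hd
  have hdc : d - d * c = 0 := by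
    have h2 : d - d * c = (x - x * c * c) - (c * c - c) := by rw [hd]; noncomm_ring
    rw [h2, ← hx, hcomm, sub_self]
  have hcd : c * d = d * c := by
    rw [hd]
    simp only [mul_add, add_mul, ← mul_assoc, hcomm]
  apply h.1
  change d - c * d * c = 0 - c * 0 * c
  rw [hcd, ← sub_eq_zero.mp hdc, ← sub_eq_zero.mp hdc]
  simp

/-- In a semisimple Banach algebra a non-zero compact element `a` yields a non-zero finite rank
element. Some `c = (λ + b) a` is not quasi-regular. By the Fredholm alternative `1` is an
eigenvalue of the compact operator `T : x ↦ c x c`; on the finite-dimensional eigenspace `E` of `T`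
left multiplication by `c` has an eigenvector `v`, and `v A v ⊆ E`. -/
theorem exists_isFiniteRankElement_of_isCompactMulElement [CompleteSpace A]
    (hA : jacobsonIdeal A = ⊥) {a : A} (ha0 : a ≠ 0) (ha : IsCompactMulElement a) :
    ∃ v : A, v ≠ 0 ∧ IsFiniteRankElement A v := by
  obtain ⟨l, b, hnot⟩ : ∃ (l : ℂ) (b : A), ¬ IsLeftQuasiRegular (l • a + b * a) := by
    by_contra! H
    have := mem_jacobsonIdeal_iff.mpr H
    rw [hA] at this
    exact ha0 this
  set c := l • a + b * a
  let T : A →L[ℂ] A := (mulRightL c).comp (mulLeftL c)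
  have hT : IsCompactOperator T := ha.smul_add_mul l b
  have heig : Module.End.HasEigenvalue (T : Module.End ℂ A) 1 := by
    refine (hT.hasEigenvalue_or_mem_resolventSet one_ne_zero).resolve_right fun hres => hnot ?_
    rw [spectrum.mem_resolventSet_iff, map_one, ContinuousLinearMap.isUnit_iff_bijective] at hres
    exact isLeftQuasiRegular_of_bijective hres
  let E := Module.End.eigenspace (T : Module.End ℂ A) 1
  have hE : ∀ x, x ∈ E ↔ c * x * c = x := by
    intro x
    rw [Module.End.mem_eigenspace_iff, one_smul]
    rfl
  have hEclosed : IsClosed (E : Set A) := by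
    have : (E : Set A) = {x | c * x * c = x} := Set.ext hE
    rw [this]
    exact isClosed_eq (by fun_prop) (by fun_prop)
  have hEfin : FiniteDimensional ℂ E := by
    have hmaps : ∀ x ∈ E, (T : A →ₗ[ℂ] A) x ∈ E := fun x hx => by
      have : (T : A →ₗ[ℂ] A) x = x := (hE x).mp hx
      rwa [this]
    have hid := IsCompactOperator.restrict (f := (T : A →ₗ[ℂ] A)) hT (V := E) hmaps hEclosed
    refine FiniteDimensional.of_isCompactOperator_id ?_
    have heq : (id : E → E) = (T : A →ₗ[ℂ] A).restrict hmaps :=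
      funext fun x => Subtype.ext ((hE x).mp x.2).symm
    rw [heq]
    exact hid
  have hEnt : Nontrivial E := Submodule.nontrivial_iff_ne_bot.mpr heig
  -- Left multiplication by `c` preserves `E`.
  let M : Module.End ℂ E := (LinearMap.mulLeft ℂ c).restrict fun x hx => by
    rw [hE] at hx ⊢
    change c * (c * x) * c = c * x
    rw [mul_assoc c (c * x) c, hx]
  obtain ⟨μ, hμ⟩ := Module.End.exists_eigenvalue M
  obtain ⟨v, hv⟩ := hμ.exists_hasEigenvector
  have hcv : c * (v : A) = μ • (v : A) := congrArg Subtype.val hv.apply_eq_smul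
  have hv0 : (v : A) ≠ 0 := fun h => hv.2 (Subtype.ext h)
  have hvc : μ • ((v : A) * c) = v := by
    rw [← smul_mul_assoc, ← hcv]
    exact (hE v).mp v.2
  refine ⟨v, hv0, ?_⟩
  have hsub :
      LinearMap.range (LinearMap.mulLeft ℂ (v : A) ∘ₗ LinearMap.mulRight ℂ (v : A)) ≤ E := by
    rintro _ ⟨x, rfl⟩
    rw [hE]
    change c * (v * (x * v)) * c = v * (x * v)
    calc c * (v * (x * v)) * c = (c * v) * (x * (v * c)) := by simp only [mul_assoc]
      _ = v * (x * (μ • ((v : A) * c))) := by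
        rw [hcv, smul_mul_assoc, mul_smul_comm, mul_smul_comm]
      _ = v * (x * v) := by rw [hvc]
  exact Submodule.finiteDimensional_of_le hsub

/-! ### Hypocompact algebras are scattered -/

theorem HasZeroPresocle.eq_zero_of_isCompactMulElement [CompleteSpace A]
    (hA : HasZeroPresocle A) {a : A} (ha : IsCompactMulElement a) : a = 0 := by
  by_contra ha0
  obtain ⟨v, hv0, hv⟩ :=
    exists_isFiniteRankElement_of_isCompactMulElement hA.jacobsonIdeal_eq_bot ha0 ha
  obtain ⟨L, hL⟩ :=
    exists_isMinimalLeftIdeal_of_isFiniteRankElement hA.jacobsonIdeal_eq_bot hv0 hv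
  exact hA.not_isMinimalLeftIdeal L hL

theorem IsHypocompact.presocleStar_eq_top [CompleteSpace A] (hA : IsHypocompact A) :
    presocleStar A = ⊤ := by
  by_contra hne
  obtain ⟨J, hJ⟩ : ∃ J : ClosedIdeal A, J.toAlgIdeal = presocleStar A :=
    ⟨⟨presocleStar A, isClosed_presocleStar A⟩, rfl⟩
  have hJz : HasZeroPresocle J.toAlgIdeal.Quot := by
    rw [hJ]
    exact hasZeroPresocle_quot_presocleStar A
  obtain ⟨a, ha0, ha⟩ := hA J (hJ.trans_ne hne)
  exact ha0 (HasZeroPresocle.eq_zero_of_isCompactMulElement (A := J.Quot) hJz ha)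

theorem hypocompactRadical_le_scatteredRadical :
    hypocompactRadical.{u} ≤ scatteredRadical.{u} := by
  intro A _ _ _ _ _
  refine AlgIdeal.closure_le (isClosed_presocleStar A) (AlgIdeal.iSup_le fun I x hx => ?_)
  have htop : presocleStar I.1.Carrier = ⊤ := I.2.presocleStar_eq_top
  have : (⟨x, hx⟩ : I.1.Carrier) ∈ presocleStar I.1.Carrier := by
    rw [htop]
    exact AlgIdeal.mem_top _
  exact coe_mem_presocleStar I.1.toAlgIdeal this

theorem IsFiniteRankElement.isCompactMulElement {a : A} (ha : IsFiniteRankElement A a) :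
    IsCompactMulElement a := by
  let T : A →L[ℂ] A := (mulLeftL a).comp (mulRightL a)
  let R := LinearMap.range (LinearMap.mulLeft ℂ a ∘ₗ LinearMap.mulRight ℂ a)
  have : FiniteDimensional ℂ R := ha
  have : ProperSpace R := FiniteDimensional.proper ℂ R
  let T' : A →L[ℂ] R := T.codRestrict R fun x => ⟨x, rfl⟩
  have hT' : IsCompactOperator T' :=
    isCompactOperator_of_locallyCompactSpace_dom T'
  have heq : (fun x : A => a * x * a) = R.subtypeL ∘ T' := funext fun x => mul_assoc a x a
  rw [IsCompactMulElement, heq]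
  exact hT'.clm_comp R.subtypeL

theorem IsHypofinite.isHypocompact (hA : IsHypofinite A) : IsHypocompact A := fun L hL => by
  obtain ⟨a, ha0, ha⟩ := hA L hL
  exact ⟨a, ha0, ha.isCompactMulElement⟩

theorem hypofiniteRadical_le_hypocompactRadical :
    hypofiniteRadical.{u} ≤ hypocompactRadical.{u} := by
  intro A _ _ _ _ _
  refine AlgIdeal.closure_le (AlgIdeal.closure _).isClosed (AlgIdeal.iSup_le fun I => ?_)
  exact fun x hx => AlgIdeal.le_closure _
    (AlgIdeal.le_iSup (fun I : {I : ClosedIdeal A // IsHypocompact I.Carrier} => I.1.toAlgIdeal)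
      ⟨I.1, I.2.isHypocompact⟩ hx)

end Banach

/-! ### Semisimple Banach algebras with non-zero socle have a hypofinite ideal -/

section Hypofinite

set_option linter.unusedSectionVars false

section Algebraic

variable {A : Type*} [NonUnitalRing A] [Module ℂ A] [IsScalarTower ℂ A A] [SMulCommClass ℂ A A]
variable {B : Type*} [NonUnitalRing B] [Module ℂ B] [IsScalarTower ℂ B B] [SMulCommClass ℂ B B]

/-- Brauer's lemma: a minimal left ideal of a semisimple algebra has a right identity. -/
theorem IsMinimalLeftIdeal.exists_right_identity (hA : jacobsonIdeal A = ⊥) {L : Submodule ℂ A}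
    (hL : IsMinimalLeftIdeal L) : ∃ e ∈ L, e ≠ 0 ∧ ∀ x ∈ L, x * e = x := by
  obtain ⟨y, hy, hLy⟩ := hL.exists_map_mulRight_eq hA
  obtain ⟨e, he, hey⟩ : y ∈ L.map (LinearMap.mulRight ℂ y) := hLy.symm ▸ hy
  have hey : e * y = y := hey
  have hker : L ⊓ LinearMap.ker (LinearMap.mulRight ℂ y) = ⊥ := by
    by_contra h0
    have := hL.eq_of_le (hL.prop.1.inf (isLeftIdeal_ker_mulRight y)) h0 inf_le_left
    rw [inf_eq_left, LinearMap.le_ker_iff_map, hLy] at this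
    exact hL.prop.2 this
  have hid : ∀ x ∈ L, x * e = x := by
    intro x hx
    have hmem : x * e - x ∈ L ⊓ LinearMap.ker (LinearMap.mulRight ℂ y) := by
      refine ⟨L.sub_mem (hL.prop.1 x e he) hx, ?_⟩
      change (x * e - x) * y = 0
      rw [sub_mul, mul_assoc, hey, sub_self]
    rw [hker, Submodule.mem_bot] at hmem
    exact sub_eq_zero.mp hmem
  refine ⟨e, he, fun h0 => hL.prop.2 ((Submodule.eq_bot_iff L).mpr fun x hx => ?_), hid⟩
  rw [← hid x hx, h0, mul_zero]

theorem IsFiniteRankElement.map {f : A →ₙₐ[ℂ] B} (hf : Function.Surjective f) {a : A}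
    (ha : IsFiniteRankElement A a) : IsFiniteRankElement B (f a) := by
  have : FiniteDimensional ℂ
    (LinearMap.range (LinearMap.mulLeft ℂ a ∘ₗ LinearMap.mulRight ℂ a)) := ha
  refine Submodule.finiteDimensional_of_le (S₂ :=
    (LinearMap.range (LinearMap.mulLeft ℂ a ∘ₗ LinearMap.mulRight ℂ a)).map (f : A →ₗ[ℂ] B)) ?_
  rintro _ ⟨y, rfl⟩
  obtain ⟨x, rfl⟩ := hf y
  refine ⟨a * (x * a), ⟨x, rfl⟩, ?_⟩
  change f (a * (x * a)) = f a * (f x * f a)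
  rw [map_mul, map_mul]

theorem IsFiniteRankElement.of_idealEmbedding {ι : A →ₙₐ[ℂ] B} (hι : IsIdealEmbedding ι) {a : A}
    (ha : IsFiniteRankElement B (ι a)) : IsFiniteRankElement A a := by
  have : FiniteDimensional ℂ
    (LinearMap.range (LinearMap.mulLeft ℂ (ι a) ∘ₗ LinearMap.mulRight ℂ (ι a))) := ha
  let R := LinearMap.range (LinearMap.mulLeft ℂ a ∘ₗ LinearMap.mulRight ℂ a)
  have hfin : FiniteDimensional ℂ (R.map (ι : A →ₗ[ℂ] B)) := by
    refine Submodule.finiteDimensional_of_le (S₂ :=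
      LinearMap.range (LinearMap.mulLeft ℂ (ι a) ∘ₗ LinearMap.mulRight ℂ (ι a))) ?_
    rintro _ ⟨_, ⟨x, rfl⟩, rfl⟩
    refine ⟨ι x, ?_⟩
    change ι a * (ι x * ι a) = ι (a * (x * a))
    rw [map_mul, map_mul]
  exact (Submodule.equivMapOfInjective (ι : A →ₗ[ℂ] B) hι.injective R).symm.finiteDimensional

theorem IsFiniteRankElement.mul_mul {a : A} (ha : IsFiniteRankElement A a) (b c : A) :
    IsFiniteRankElement A (b * a * c) := by
  have : FiniteDimensional ℂ
    (LinearMap.range (LinearMap.mulLeft ℂ a ∘ₗ LinearMap.mulRight ℂ a)) := ha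
  refine Submodule.finiteDimensional_of_le (S₂ :=
    (LinearMap.range (LinearMap.mulLeft ℂ a ∘ₗ LinearMap.mulRight ℂ a)).map
      (LinearMap.mulLeft ℂ b ∘ₗ LinearMap.mulRight ℂ c)) ?_
  rintro _ ⟨x, rfl⟩
  refine ⟨a * ((c * x * b) * a), ⟨c * x * b, rfl⟩, ?_⟩
  change b * (a * (c * x * b * a) * c) = b * a * c * (x * (b * a * c))
  simp only [mul_assoc]

/-- The linear span of `A a A`. -/
def AlgIdeal.spanMulMul (a : A) : AlgIdeal A where
  toSubmodule := Submodule.span ℂ {x | ∃ b c, b * a * c = x}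
  mul_left_mem := by
    intro d x hx
    have h : Submodule.span ℂ {x | ∃ b c, b * a * c = x} ≤
        (Submodule.span ℂ {x | ∃ b c, b * a * c = x}).comap (LinearMap.mulLeft ℂ d) := by
      rw [Submodule.span_le]
      rintro _ ⟨b, c, rfl⟩
      exact Submodule.subset_span ⟨d * b, c, by simp [mul_assoc]⟩
    exact h hx
  mul_right_mem := by
    intro x d hx
    have h : Submodule.span ℂ {x | ∃ b c, b * a * c = x} ≤
        (Submodule.span ℂ {x | ∃ b c, b * a * c = x}).comap (LinearMap.mulRight ℂ d) := by
      rw [Submodule.span_le]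
      rintro _ ⟨b, c, rfl⟩
      exact Submodule.subset_span ⟨b, c * d, by simp [mul_assoc]⟩
    exact h hx

theorem AlgIdeal.mul_mul_mem_spanMulMul (a b c : A) : b * a * c ∈ AlgIdeal.spanMulMul a :=
  Submodule.subset_span (s := {x | ∃ b c, b * a * c = x}) ⟨b, c, rfl⟩

theorem AlgIdeal.isIdealEmbedding_incl (I : AlgIdeal A) : IsIdealEmbedding I.incl where
  injective := Subtype.val_injective
  mul_left b n := ⟨⟨b * n, I.mul_left_mem b n.2⟩, rfl⟩
  mul_right n b := ⟨⟨n * b, I.mul_right_mem b n.2⟩, rfl⟩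

end Algebraic

variable {A : Type u} [NonUnitalNormedRing A] [NormedSpace ℂ A] [IsScalarTower ℂ A A]
  [SMulCommClass ℂ A A]

/-- On a minimal left ideal `L` of a semisimple Banach algebra, right multiplication by `w ∈ L` is
scalar: `L` is closed, the operator minus a point `μ` of its spectrum is not bijective, and its
kernel and range are left ideals. -/
theorem IsMinimalLeftIdeal.exists_mul_eq_smul [CompleteSpace A] (hA : jacobsonIdeal A = ⊥)
    {L : Submodule ℂ A} (hL : IsMinimalLeftIdeal L) {w : A} (hw : w ∈ L) :
    ∃ μ : ℂ, ∀ x ∈ L, x * w = μ • x := by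
  obtain ⟨e, he, -, hid⟩ := hL.exists_right_identity hA
  have hclosed : IsClosed (L : Set A) := by
    have : (L : Set A) = {x | x * e = x} := by
      ext x
      exact ⟨hid x, fun h : x * e = x => h ▸ hL.prop.1 x e he⟩
    rw [this]
    exact isClosed_eq (by fun_prop) continuous_id
  have : CompleteSpace L := hclosed.completeSpace_coe
  have : Nontrivial L := Submodule.nontrivial_iff_ne_bot.mpr hL.prop.2
  let T : L →L[ℂ] L := ((mulRightL w).comp L.subtypeL).codRestrict L
    fun x => hL.prop.1 x w hw
  obtain ⟨μ, hμ⟩ := spectrum.nonempty T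
  rw [spectrum.mem_iff, ContinuousLinearMap.isUnit_iff_bijective] at hμ
  refine ⟨μ, ?_⟩
  let S : A →ₗ[ℂ] A := μ • LinearMap.id - LinearMap.mulRight ℂ w
  have hS : ∀ x, S x = μ • x - x * w := fun _ => rfl
  have hval : ∀ x : L, (((algebraMap ℂ (L →L[ℂ] L) μ - T) x : L) : A) = S x := fun _ => rfl
  have hmul : ∀ a x, S (a * x) = a * S x := fun a x => by
    rw [hS, hS, mul_sub, mul_smul_comm, mul_assoc]
  have hker : IsLeftIdeal (L ⊓ LinearMap.ker S) := hL.prop.1.inf fun a x hx => by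
    rw [LinearMap.mem_ker] at hx ⊢
    rw [hmul, hx, mul_zero]
  by_cases hk : L ⊓ LinearMap.ker S = ⊥
  · exfalso
    refine hμ ⟨?_, ?_⟩
    · rw [injective_iff_map_eq_zero]
      intro x hx
      have h0 : S x = 0 := by rw [← hval, hx]; rfl
      have : (x : A) ∈ L ⊓ LinearMap.ker S := ⟨x.2, h0⟩
      rw [hk] at this
      exact Subtype.ext this
    · have hmapl : IsLeftIdeal (L.map S) := by
        rintro a _ ⟨x, hx, rfl⟩
        exact ⟨a * x, hL.prop.1 a x hx, hmul a x⟩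
      have hmap : L.map S = L := by
        refine hL.eq_of_le hmapl (fun h0 => ?_) ?_
        · rw [← LinearMap.le_ker_iff_map] at h0
          rw [inf_eq_left.mpr h0] at hk
          exact hL.prop.2 hk
        · rintro _ ⟨x, hx, rfl⟩
          exact L.sub_mem (L.smul_mem μ hx) (hL.prop.1 x w hw)
      intro y
      obtain ⟨x, hx, hxy⟩ : (y : A) ∈ L.map S := hmap.symm ▸ y.2
      exact ⟨⟨x, hx⟩, Subtype.ext hxy⟩
  · intro x hx
    rw [← hL.eq_of_le hker hk inf_le_left] at hx
    exact (sub_eq_zero.mp hx.2).symm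

/-- The closed ideal generated by `A a A` is hypofinite if `a` has finite rank. -/
theorem IsFiniteRankElement.isHypofinite_closure {a : A} (ha : IsFiniteRankElement A a) :
    IsHypofinite (AlgIdeal.spanMulMul a).closure.Carrier := by
  set I := (AlgIdeal.spanMulMul a).closure with hI
  intro M hM
  by_contra! H
  have hgen : ∀ b c, ∃ x ∈ M.toAlgIdeal, I.toAlgIdeal.incl x = b * a * c := by
    intro b c
    let x : I.Carrier := ⟨b * a * c, AlgIdeal.le_closure _ (AlgIdeal.mul_mul_mem_spanMulMul a b c)⟩
    have hx : IsFiniteRankElement I.Carrier x :=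
      .of_idealEmbedding I.toAlgIdeal.isIdealEmbedding_incl (ha.mul_mul b c)
    have hq := hx.map M.toAlgIdeal.quotMap_surjective
    by_contra! hne
    refine H (M.toAlgIdeal.quotMap x) (fun h0 => ?_) hq
    exact hne x (AlgIdeal.quotMap_eq_zero.mp h0) rfl
  apply hM
  -- The image of `M` in the whole algebra is closed and contains `b a c` for all `b`, `c`.
  let M' : Submodule ℂ A :=
    M.toSubmodule.map (I.toAlgIdeal.incl : I.toAlgIdeal.toSubalg →ₗ[ℂ] A)
  have hclosed : IsClosed (M' : Set A) :=
    I.isClosed.isClosedEmbedding_subtypeVal.isClosedMap _ M.isClosed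
  have hspan : (AlgIdeal.spanMulMul a).toSubmodule ≤ M' := by
    refine Submodule.span_le.mpr ?_
    rintro _ ⟨b, c, rfl⟩
    obtain ⟨x, hx, hxe⟩ := hgen b c
    exact ⟨x, hx, hxe⟩
  refine le_antisymm (fun _ _ => trivial) fun x _ => ?_
  have hx : (x : A) ∈ M' :=
    closure_minimal (show ((AlgIdeal.spanMulMul a : AlgIdeal A) : Set A) ⊆ M' from hspan)
      hclosed x.2
  obtain ⟨y, hy, hyx⟩ := hx
  rwa [← show y = x from Subtype.ext hyx]

/-- If `A` is semisimple and has no hypofinite ideals, then it has no minimal left ideals: the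
idempotent `e` of a minimal left ideal satisfies `e A e ⊆ ℂ e`, and generates a hypofinite
ideal. -/
theorem hasZeroPresocle_of_hypofiniteRadical_eq_bot [CompleteSpace A]
    (hA : jacobsonIdeal A = ⊥) (h : hypofiniteRadical A = ⊥) : HasZeroPresocle A := by
  refine ⟨hA, fun L hL => ?_⟩
  obtain ⟨e, he, he0, hid⟩ := hL.exists_right_identity hA
  have hfin : IsFiniteRankElement A e := by
    refine Submodule.finiteDimensional_of_le (S₂ := Submodule.span ℂ {e}) ?_
    rintro _ ⟨x, rfl⟩
    obtain ⟨μ, hμ⟩ := hL.exists_mul_eq_smul hA (hL.prop.1 x e he)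
    exact Submodule.mem_span_singleton.mpr ⟨μ, (hμ e he).symm⟩
  have hmem : e ∈ (AlgIdeal.spanMulMul e).closure.toAlgIdeal := by
    refine AlgIdeal.le_closure _ ?_
    have := AlgIdeal.mul_mul_mem_spanMulMul e e e
    rwa [hid e he, hid e he] at this
  have : e ∈ hypofiniteRadical A := AlgIdeal.le_closure _
    (AlgIdeal.le_iSup (fun I : {I : ClosedIdeal A // IsHypofinite I.Carrier} => I.1.toAlgIdeal)
      ⟨_, hfin.isHypofinite_closure⟩ hmem)
  rw [h] at this
  exact he0 this

end Hypofinite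

/-! ### The scattered radical as a supremum -/

section Supremum

variable {A : Type u} [NonUnitalNormedRing A] [NormedSpace ℂ A] [IsScalarTower ℂ A A]
  [SMulCommClass ℂ A A] [CompleteSpace A]

/-- The scattered radical lies in every closed ideal modulo which both the hypofinite and the
Jacobson radicals vanish. -/
theorem presocleStar_le_of_quot {K : ClosedIdeal A} (hhf : hypofiniteRadical K.Quot = ⊥)
    (hrad : jacobsonRadical K.Quot = ⊥) : presocleStar A ≤ K.toAlgIdeal := by
  have h : HasZeroPresocle K.Quot := hasZeroPresocle_of_hypofiniteRadical_eq_bot hrad hhf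
  exact presocleStar_le h

namespace IdealMap

theorem isTopologicalRadical_scatteredRadical : scatteredRadical.{u}.IsTopologicalRadical where
  isClosed A _ _ _ _ _ := isClosed_presocleStar A
  map_mem A B _ _ _ _ _ _ _ _ _ _ f _ _ hf x hx := map_mem_presocleStar hf hx
  quotient_eq_bot A _ _ _ _ _ I hI := by
    have hI : I.toAlgIdeal = presocleStar A := hI
    have : presocleStar I.toAlgIdeal.Quot = ⊥ := by
      rw [hI]
      exact presocleStar_quot A
    exact this
  idem A _ _ _ _ _ I hI :=
    le_antisymm (fun _ _ => trivial) fun x _ =>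
      mem_presocleStar_of_coe_mem I.toAlgIdeal (hI.le x.2)
  ideal A _ _ _ _ _ I := by
    let K := presocleStar I.toAlgIdeal.toSubalg
    refine ⟨I.toAlgIdeal.ofQuotSemisimple K
      (hasZeroPresocle_quot_presocleStar _).jacobsonIdeal_eq_bot, rfl, ?_⟩
    rintro _ ⟨x, hx, rfl⟩
    exact coe_mem_presocleStar I.toAlgIdeal hx

variable (P Q : IdealMap.{u})

variable (A) in
theorem convChain_zero : convChain P Q A 0 = ⊥ := Ordinal.limitRecOn_zero ..

variable (A) in
theorem convChain_add_one (o : Ordinal.{u}) : convChain P Q A (o + 1) =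
    (convChain P Q A o).preimage (closedSum P Q (convChain P Q A o).Quot) :=
  Ordinal.limitRecOn_add_one ..

variable (A) in
theorem convChain_limit {o : Ordinal.{u}} (ho : Order.IsSuccLimit o) : convChain P Q A o =
    AlgIdeal.closure (AlgIdeal.iSup fun γ : Set.Iio o => (convChain P Q A γ.1).toAlgIdeal) :=
  Ordinal.limitRecOn_limit _ _ _ _ ho

theorem left_le_closedSum : P A ≤ (closedSum P Q A).toAlgIdeal := fun _ hx =>
  AlgIdeal.le_closure _ (AlgIdeal.le_iSup (fun b : Bool => if b then P A else Q A) true hx)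

theorem right_le_closedSum : Q A ≤ (closedSum P Q A).toAlgIdeal := fun _ hx =>
  AlgIdeal.le_closure _ (AlgIdeal.le_iSup (fun b : Bool => if b then P A else Q A) false hx)

theorem closedSum_le {J : AlgIdeal A} (hJ : IsClosed (J : Set A)) (hP : P A ≤ J) (hQ : Q A ≤ J) :
    (closedSum P Q A).toAlgIdeal ≤ J := by
  refine AlgIdeal.closure_le hJ (AlgIdeal.iSup_le fun b => ?_)
  cases b
  · exact hQ
  · exact hP

variable (A) in
/-- Both ideal maps vanish modulo some member of their convolution chain. -/
theorem exists_convChain_quot_eq_bot : ∃ o : Ordinal.{u},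
    P (convChain P Q A o).Quot = ⊥ ∧ Q (convChain P Q A o).Quot = ⊥ := by
  obtain ⟨o, ho⟩ := exists_eq_add_one_of_chain (fun o => (convChain P Q A o).toAlgIdeal)
    (fun o => by rw [convChain_add_one]; exact AlgIdeal.le_preimage _ _)
    (fun o ho γ hγ => by
      rw [convChain_limit A P Q ho]
      exact fun x hx => AlgIdeal.le_closure _
        (AlgIdeal.le_iSup (fun γ : Set.Iio o => (convChain P Q A γ.1).toAlgIdeal) ⟨γ, hγ⟩ hx))
  rw [convChain_add_one] at ho
  have hbot : (closedSum P Q (convChain P Q A o).Quot).toAlgIdeal = ⊥ :=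
    AlgIdeal.eq_bot_of_preimage_le ho.ge
  exact ⟨o, AlgIdeal.le_bot_iff.mp ((left_le_closedSum P Q).trans hbot.le),
    AlgIdeal.le_bot_iff.mp ((right_le_closedSum P Q).trans hbot.le)⟩

theorem join_le_scatteredRadical (hP : P ≤ scatteredRadical.{u}) (hQ : Q ≤ scatteredRadical.{u}) :
    join P Q ≤ scatteredRadical.{u} := by
  intro A _ _ _ _ _
  refine AlgIdeal.iSup_le fun o => ?_
  induction o using Ordinal.limitRecOn with
  | zero => rw [convChain_zero]; exact AlgIdeal.bot_le _
  | add_one o ih =>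
    rw [convChain_add_one]
    intro x hx
    have hx : (convChain P Q A o).toAlgIdeal.quotMap x ∈
      (closedSum P Q (convChain P Q A o).Quot).toAlgIdeal := hx
    have hs := closedSum_le P Q (isClosed_presocleStar (convChain P Q A o).Quot) (hP _) (hQ _) hx
    have h0 : presocleStar (convChain P Q A o).toAlgIdeal.Quot ≤
        AlgIdeal.ker ((convChain P Q A o).toAlgIdeal.lift (presocleStar A).quotMap
          fun y hy => AlgIdeal.quotMap_eq_zero.mpr (ih hy)) :=
      presocleStar_le_ker (AlgIdeal.lift_surjective _ _ (AlgIdeal.quotMap_surjective _))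
        (hasZeroPresocle_quot_presocleStar A)
    exact AlgIdeal.quotMap_eq_zero.mp (h0 hs)
  | limit o ho ih =>
    rw [convChain_limit A P Q ho]
    exact AlgIdeal.closure_le (isClosed_presocleStar A) (AlgIdeal.iSup_le fun γ => ih γ.1 γ.2)

theorem hypofinite_eq_bot_of_le {P : IdealMap.{u}} (hP : hypofiniteRadical ≤ P)
    (h : P A = ⊥) : hypofiniteRadical A = ⊥ :=
  AlgIdeal.le_bot_iff.mp ((hP A).trans h.le)

theorem scatteredRadical_eq_join {P : IdealMap.{u}} (hP : hypofiniteRadical ≤ P)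
    (hPs : P ≤ scatteredRadical) : scatteredRadical.{u} = join P jacobsonRadical.{u} := by
  ext A _ _ _ _ _ x
  constructor
  · intro hx
    obtain ⟨o, hoP, hoQ⟩ := exists_convChain_quot_eq_bot A P jacobsonRadical
    exact AlgIdeal.le_iSup (fun o => (convChain P jacobsonRadical A o).toAlgIdeal) o
      (presocleStar_le_of_quot (hypofinite_eq_bot_of_le hP hoP) hoQ hx)
  · exact fun hx => join_le_scatteredRadical P jacobsonRadical hPs
      (fun A _ _ _ _ _ => jacobsonIdeal_le_presocleStar A) A hx

theorem scatteredRadical_isRadicalSupremum {P : IdealMap.{u}} (hP : hypofiniteRadical ≤ P)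
    (hPs : P ≤ scatteredRadical) :
    IsRadicalSupremum scatteredRadical.{u} P jacobsonRadical.{u} := by
  refine ⟨isTopologicalRadical_scatteredRadical, hPs,
    fun A _ _ _ _ _ => jacobsonIdeal_le_presocleStar A, fun T hT hPT hJT A _ _ _ _ _ => ?_⟩
  obtain ⟨K, hK⟩ : ∃ K : ClosedIdeal A, K.toAlgIdeal = T A := ⟨⟨T A, hT.isClosed A⟩, rfl⟩
  have h0 : T K.Quot = ⊥ := hT.quotient_eq_bot A K hK
  rw [← hK]
  exact presocleStar_le_of_quot
    (hypofinite_eq_bot_of_le hP (AlgIdeal.le_bot_iff.mp ((hPT _).trans h0.le)))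
    (AlgIdeal.le_bot_iff.mp ((hJT _).trans h0.le))

end IdealMap

end Supremum

theorem mainTheorem7 :
    hypocompactRadical.{u} ≤ scatteredRadical.{u} ∧
    scatteredRadical.{u} = IdealMap.join hypofiniteRadical.{u} jacobsonRadical.{u} ∧
    scatteredRadical.{u} = IdealMap.join hypocompactRadical.{u} jacobsonRadical.{u} ∧
    IdealMap.IsRadicalSupremum scatteredRadical.{u} hypofiniteRadical.{u} jacobsonRadical.{u} ∧
    IdealMap.IsRadicalSupremum scatteredRadical.{u} hypocompactRadical.{u} jacobsonRadical.{u} := by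
  have hc := hypocompactRadical_le_scatteredRadical.{u}
  have hfc := hypofiniteRadical_le_hypocompactRadical.{u}
  have hff : hypofiniteRadical.{u} ≤ hypofiniteRadical.{u} := fun A _ _ _ _ _ => le_rfl
  have hf : hypofiniteRadical.{u} ≤ scatteredRadical.{u} :=
    fun A _ _ _ _ _ => (hfc A).trans (hc A)
  exact ⟨hc, IdealMap.scatteredRadical_eq_join hff hf, IdealMap.scatteredRadical_eq_join hfc hc,
    IdealMap.scatteredRadical_isRadicalSupremum hff hf,
    IdealMap.scatteredRadical_isRadicalSupremum hfc hc⟩
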